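/- Let $q$ be an odd prime power with $q\equiv 7 \pmod{10}$, and put $n=\frac{q^2+1}{10}$, $r=q+1$, $s=\frac{q^2+1}{2}$. Let $\alpha\in\mathbb F_{q^2}^*$ be a primitive $r$-th root of unity and let $\delta$, in an extension field of $\mathbb F_{q^2}$, be a primitive $rn$-th root of unity with $\delta^n=\alpha$. For an integer $i$ let $C_i=\{iq^{2j} \bmod rn : j\ge 0\}$ be its $q^2$-cyclotomic coset modulo $rn$. Let $1\le\lambda\le\frac{q-7}{10}$ be an integer and let $\mathcal C=\langle g(x)\rangle\subseteq\mathbb F_{q^2}[x]/\langle x^n-\alpha\rangle$, with $g$ monic and $g\mid x^n-\alpha$, be the $\alpha$-constacyclic code of length $n$ whose defining set $\{i\in\{1+rj : 0\le j\le n-1\} : g(\delta^i)=0\}$ (modulo $rn$) is $$T=\bigcup_{j=0}^{\frac{2q+1}{5}+\lambda} C_{s-rj}.$$ Put $k=n-\frac45(2q+1)-4\lambda+7$ and $d=\frac25(2q+1)+2\lambda+2$. Then $\mathcal C$ has minimum distance $d$; every parity check matrix $H$ of $\mathcal C$ satisfies $\operatorname{rank}(HH^*)=9$, where $H^*$ is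 the conjugate transpose of $H$ with respect to $x\mapsto x^q$; $k=2\dim\mathcal C-n+9$; and there exists an entanglement-assisted quantum code with parameters $$[[\,n,\ n-\tfrac45(2q+1)-4\lambda+7,\ \tfrac25(2q+1)+2\lambda+2;\ 9\,]]_q,$$ that is, a code which encodes $k$ qudits of dimension $q$ into $n$ qudits, uses $9$ maximally entangled pairs of qudits shared by sender and receiver (the receiver's halves being free of errors), and has minimum distance exactly $d$. It attains equality $n+9-k=2(d-1)$ in the entanglement-assisted Singleton bound, and if $q\neq 17$ then also $d\le\frac{n+2}{2}$, so that it is an entanglement-assisted quantum MDS (EAQMDS) code. -/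

import Mathlib

/-! ### Constacyclic codes over a field with `q ^ 2` elements -/

/-- The constacyclic shift `(c₀, …, cₙ₋₁) ↦ (α cₙ₋₁, c₀, …, cₙ₋₂)`. -/
def constaShift {F : Type*} [Field F] {n : ℕ} (α : F) (c : Fin n → F) : Fin n → F :=
  fun i => if i.val = 0 then α * c ⟨n - 1, by have := i.isLt; omega⟩
    else c ⟨i.val - 1, by have := i.isLt; omega⟩

/-- A linear code is `α`-constacyclic if it is closed under the constacyclic shift. -/
def IsConstacyclic {F : Type*} [Field F] {n : ℕ} (α : F) (C : Submodule F (Fin n → F)) : Prop :=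
  ∀ c ∈ C, constaShift α c ∈ C

/-- The polynomial `c₀ + c₁ X + ⋯ + cₙ₋₁ Xⁿ⁻¹` of a word. -/
noncomputable def wordPoly {F : Type*} [Field F] {n : ℕ} (c : Fin n → F) : Polynomial F :=
  ∑ i : Fin n, Polynomial.C (c i) * Polynomial.X ^ i.val

/-- `C = ⟨g⟩` in `F[X] / (Xⁿ - α)`, with `g` monic and `g ∣ Xⁿ - α`. -/
structure IsGeneratorPoly {F : Type*} [Field F] {n : ℕ} (α : F) (C : Submodule F (Fin n → F))
    (g : Polynomial F) : Prop where
  monic : g.Monic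
  dvd : g ∣ Polynomial.X ^ n - Polynomial.C α
  mem_iff : ∀ c : Fin n → F, c ∈ C ↔ g ∣ wordPoly c

/-- The exponents `i ∈ {1 + r j | 0 ≤ j ≤ n - 1}` modulo `r n` for which `δ ^ i` is a root of the
generator polynomial `g`; here `δ` is a primitive `r n`-th root of unity in an extension field. -/
def definingSet {F K : Type*} [Field F] [Field K] [Algebra F K] (r n : ℕ) (δ : K)
    (g : Polynomial F) : Set (ZMod (r * n)) :=
  {i | (∃ j : ℕ, j < n ∧ i = 1 + (r : ZMod (r * n)) * (j : ZMod (r * n))) ∧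
    Polynomial.aeval (δ ^ i.val) g = 0}

/-- The `q ^ 2`-cyclotomic coset of `i` modulo `N`. -/
def cyclotomicCoset (q N : ℕ) (i : ZMod N) : Set (ZMod N) :=
  {x | ∃ j : ℕ, x = i * (q : ZMod N) ^ (2 * j)}

/-- `d` is the minimum weight of the nonzero words of the linear code `C`. -/
def HasMinWeight {F : Type*} [Field F] [DecidableEq F] {n : ℕ} (C : Submodule F (Fin n → F))
    (d : ℕ) : Prop :=
  IsLeast {w | ∃ c ∈ C, c ≠ 0 ∧ hammingNorm c = w} d

/-- `H` is a parity check matrix of `C`, with linearly independent rows. -/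
def IsParityCheck {F : Type*} [Field F] {m n : ℕ} (C : Submodule F (Fin n → F))
    (H : Matrix (Fin m) (Fin n) F) : Prop :=
  LinearIndependent F H.row ∧ ∀ x : Fin n → F, x ∈ C ↔ H.mulVec x = 0

/-- The conjugate transpose of a matrix over a field with `q ^ 2` elements, for the conjugation
`x ↦ x ^ q`. -/
def hermTranspose {F : Type*} [Field F] {m n : ℕ} (q : ℕ) (H : Matrix (Fin m) (Fin n) F) :
    Matrix (Fin n) (Fin m) F :=
  fun j i => H i j ^ q

/-! ### Entanglement-assisted quantum codes -/

/-- An entanglement-assisted quantum code that encodes `k` qudits of dimension `q` into `n` qudits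
with the help of `c` maximally entangled pairs of qudits shared by sender and receiver.

The registers of `m` qudits have the Hilbert space with orthonormal basis `Fin m → Fin q`. The
encoder is an isometry which the sender applies to the `k` message qudits together with her halves
of the `c` pairs (a unitary operation on these and on `n - k - c` ancillas in a fixed state). -/
structure EACode (q n k c : ℕ) where
  encoder : Matrix (Fin n → Fin q) ((Fin k → Fin q) × (Fin c → Fin q)) ℂ
  isometry : encoder.conjTranspose * encoder = 1

/-- The map that takes a message `ψ` to the joint state of the `n` transmitted qudits and the `c`
qudits kept by the receiver: the encoder applied to `ψ ⊗ Φ`, for the maximally entangled state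
`Φ = q ^ (- c / 2) ∑_b |b⟩ ⊗ |b⟩`. Its range is the code, a subspace of dimension `q ^ k`. -/
noncomputable def EACode.encode {q n k c : ℕ} (Q : EACode q n k c) :
    Matrix ((Fin n → Fin q) × (Fin c → Fin q)) (Fin k → Fin q) ℂ :=
  fun ab x => (((Real.sqrt ((q : ℝ) ^ c))⁻¹ : ℝ) : ℂ) * Q.encoder ab.1 (x, ab.2)

/-- The operator `E` on `n` qudits acts only on the qudits in `S`, i.e. `E = e ⊗ 1` for an operator
`e` on the qudits in `S`. -/
def ActsOn {q n : ℕ} (S : Finset (Fin n))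
    (E : Matrix (Fin n → Fin q) (Fin n → Fin q) ℂ) : Prop :=
  ∃ e : Matrix (S → Fin q) (S → Fin q) ℂ, ∀ x y : Fin n → Fin q,
    ((∀ i, i ∉ S → x i = y i) → E x y = e (fun i => x i) (fun i => y i)) ∧
    ((¬ ∀ i, i ∉ S → x i = y i) → E x y = 0)

/-- The Knill-Laflamme condition for detecting the error `E` on the transmitted qudits, where the
receiver's halves of the entangled pairs are free of errors: `E ⊗ 1`, compressed to the code, is a
scalar. -/
def EACode.Detects {q n k c : ℕ} (Q : EACode q n k c)
    (E : Matrix (Fin n → Fin q) (Fin n → Fin q) ℂ) : Prop :=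
  ∃ z : ℂ, Q.encode.conjTranspose *
    Matrix.kronecker E (1 : Matrix (Fin c → Fin q) (Fin c → Fin q) ℂ) * Q.encode =
      z • (1 : Matrix (Fin k → Fin q) (Fin k → Fin q) ℂ)

/-- The minimum distance is `d`, i.e. the code has parameters `[[n, k, d; c]]_q`: all errors on
fewer than `d` qudits are detected, but some error on `d` qudits is not. -/
def EACode.HasMinDist {q n k c : ℕ} (Q : EACode q n k c) (d : ℕ) : Prop :=
  (∀ S : Finset (Fin n), S.card < d → ∀ E, ActsOn S E → Q.Detects E) ∧
  ∃ S : Finset (Fin n), S.card = d ∧ ∃ E, ActsOn S E ∧ ¬ Q.Detects E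

/-- Equality `n + c - k = 2 (d - 1)` in the entanglement-assisted Singleton bound. -/
def MeetsEASingleton (n k d c : ℕ) : Prop :=
  (n : ℤ) + c - k = 2 * ((d : ℤ) - 1)

/-- An entanglement-assisted quantum MDS code: a code with parameters `[[n, k, d; c]]_q`, where
`d ≤ (n + 2) / 2`, that meets the entanglement-assisted Singleton bound. -/
def EACode.IsEAQMDS {q n k c : ℕ} (Q : EACode q n k c) (d : ℕ) : Prop :=
  Q.HasMinDist d ∧ MeetsEASingleton n k d c ∧ (d : ℚ) ≤ ((n : ℚ) + 2) / 2

/-!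
The roots of `g` are the `δ ^ (s + r j)` with `-m ≤ j ≤ m`, where `m = (2 q + 1) / 5 + l`: since
`s q ^ 2 = s` and `r q ^ 2 = -r` modulo `r n`, the coset of `s - r j` is `{s - r j, s + r j}`. So
`g` has degree `2 m + 1`, the BCH bound gives minimum distance at least `2 m + 2`, and the word of
`g` itself has at most `2 m + 2` nonzero letters.

The rank of `H H*` does not depend on the parity check matrix. Over the extension field one may take
for `H` the matrix which evaluates words at the roots of `g`; the entries of `H H*` are then
geometric sums, and the rank is the number of roots `x` of `g` for which `x ^ (-q)` is a root as
well. For `x = δ ^ (s + r i)` the condition is `n ∣ i + q j` for some `j` with `|j| ≤ m`. With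
`q = 10 t + 7`, the solutions of this congruence form a lattice with an orthogonal basis of vectors
with the entries `±(t + 1)` and `±(3 t + 2)`, and `4 t + 3 ≤ m ≤ 5 t + 3` leaves exactly the nine
combinations with coefficients in `{-1, 0, 1}`.

For the quantum code, the trace of a multiple of the Hermitian form makes the space of words a
symplectic space over the field with `q` elements. Hyperbolic bases of `C` and of its dual, modulo
their common radical, label the logical operators and the operators on the receiver's halves of the
entangled pairs; the encoder shifts a state that is stabilized by the radical and by one half of
each basis. Up to scalars, the Weyl operators which are not detected are those of words in `C`
outside the Hermitian dual of `C`. The shifts of `g` span `C` and have weight at most `2 m + 2`, so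
some word of minimum weight lies outside the dual.
-/

/-! ### Hyperbolic bases of alternating forms -/

section Hyperbolic

variable {k V : Type*} [Field k] [AddCommGroup V] [Module k V] {ω : LinearMap.BilinForm k V}

/-- Families `x` and `z` of vectors with `ω (x i) (z j) = δ i j` and all other products zero: the
hyperbolic pairs of a symplectic basis of their span. -/
structure IsHyperbolic {ι : Type*} [DecidableEq ι] (ω : LinearMap.BilinForm k V)
    (x z : ι → V) : Prop where
  xx : ∀ i j, ω (x i) (x j) = 0
  zz : ∀ i j, ω (z i) (z j) = 0
  xz : ∀ i j, ω (x i) (z j) = if i = j then 1 else 0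

/-- The products of a vector with the members of the families `z` and `x`, in this order: for a
hyperbolic pair of families these are the coordinates recovered by `hyperbolicSum`. -/
def pairingCoords {ι : Type*} (ω : LinearMap.BilinForm k V) (x z : ι → V) :
    V →ₗ[k] (ι → k) × (ι → k) :=
  (LinearMap.pi fun i => ω.flip (z i)).prod (LinearMap.pi fun i => ω.flip (x i))

/-- The combination of the families `x` and `z` with coordinates `ab`. The sign makes
`pairingCoords` its left inverse. -/
def hyperbolicSum {ι : Type*} [Fintype ι] (x z : ι → V) (ab : (ι → k) × (ι → k)) : V :=
  ∑ i, (ab.1 i • x i - ab.2 i • z i)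

theorem pairingCoords_apply {ι : Type*} (x z : ι → V) (v : V) :
    pairingCoords ω x z v = (fun i => ω v (z i), fun i => ω v (x i)) := rfl

theorem pairingCoords_eq_zero_iff {ι : Type*} {x z : ι → V} {v : V} :
    pairingCoords ω x z v = 0 ↔ (∀ i, ω v (z i) = 0) ∧ ∀ i, ω v (x i) = 0 := by
  simp only [pairingCoords_apply, Prod.mk_eq_zero, funext_iff, Pi.zero_apply]

theorem apply_hyperbolicSum {ι : Type*} [Fintype ι] (x z : ι → V) (v : V)
    (ab : (ι → k) × (ι → k)) :
    ω v (hyperbolicSum x z ab) = ∑ i, (ab.1 i * ω v (x i) - ab.2 i * ω v (z i)) := by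
  simp [hyperbolicSum]

namespace IsHyperbolic

theorem zx {ι : Type*} [DecidableEq ι] {x z : ι → V} (h : IsHyperbolic ω x z) (hω : ω.IsAlt)
    (i j : ι) : ω (z i) (x j) = if i = j then -1 else 0 := by
  rw [← hω.neg_eq, h.xz]
  by_cases hij : i = j
  · simp [hij]
  · simp [hij, Ne.symm hij]

theorem pairingCoords_hyperbolicSum {ι : Type*} [Fintype ι] [DecidableEq ι] {x z : ι → V}
    (h : IsHyperbolic ω x z) (hω : ω.IsAlt) (ab : (ι → k) × (ι → k)) :
    pairingCoords ω x z (hyperbolicSum x z ab) = ab := by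
  rw [pairingCoords_apply]
  ext j <;> simp [hyperbolicSum, h.xx, h.zz, h.xz, h.zx hω]

theorem surjective_pairingCoords {ι : Type*} [Finite ι] [DecidableEq ι] {x z : ι → V}
    (h : IsHyperbolic ω x z) (hω : ω.IsAlt) : Function.Surjective (pairingCoords ω x z) := by
  have := Fintype.ofFinite ι
  exact fun ab => ⟨_, h.pairingCoords_hyperbolicSum hω ab⟩

theorem pairingCoords_sub_hyperbolicSum {ι : Type*} [Fintype ι] [DecidableEq ι] {x z : ι → V}
    (h : IsHyperbolic ω x z) (hω : ω.IsAlt) (v : V) :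
    pairingCoords ω x z (v - hyperbolicSum x z (pairingCoords ω x z v)) = 0 := by
  rw [map_sub, h.pairingCoords_hyperbolicSum hω, sub_self]

theorem card_le_finrank [FiniteDimensional k V] {m : ℕ} {x z : Fin m → V}
    (h : IsHyperbolic ω x z) (hω : ω.IsAlt) : m ≤ Module.finrank k V := by
  have := LinearMap.finrank_le_finrank_of_surjective (h.surjective_pairingCoords hω)
  rw [Module.finrank_prod, Module.finrank_fin_fun] at this
  omega

theorem snoc {m : ℕ} {x z : Fin m → V} (h : IsHyperbolic ω x z) (hω : ω.IsAlt)
    {u v : V} (hu : pairingCoords ω x z u = 0) (hv : pairingCoords ω x z v = 0)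
    (huv : ω u v = 1) :
    IsHyperbolic ω (Fin.snoc x u : Fin (m + 1) → V) (Fin.snoc z v : Fin (m + 1) → V) := by
  obtain ⟨huz, hux⟩ := pairingCoords_eq_zero_iff.1 hu
  obtain ⟨hvz, hvx⟩ := pairingCoords_eq_zero_iff.1 hv
  have hxu (i) : ω (x i) u = 0 := hω.isRefl u (x i) (hux i)
  have hzv (i) : ω (z i) v = 0 := hω.isRefl v (z i) (hvz i)
  have hxv (i) : ω (x i) v = 0 := hω.isRefl v (x i) (hvx i)
  constructor <;> intro i j <;> refine Fin.lastCases ?_ (fun i => ?_) i <;>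
    refine Fin.lastCases ?_ (fun j => ?_) j <;>
    simp [hux, hxu, h.xx, hω.self_eq_zero, hvz, hzv, h.zz, huz, hxv, h.xz, huv,
      Fin.castSucc_ne_last, (Fin.castSucc_ne_last _).symm]

theorem exists_succ {m : ℕ} {x z : Fin m → V} (h : IsHyperbolic ω x z) (hω : ω.IsAlt)
    {v u : V} (hv : pairingCoords ω x z v = 0) (hvu : ω v u ≠ 0) :
    ∃ x' z' : Fin (m + 1) → V, IsHyperbolic ω x' z' := by
  set y := u - hyperbolicSum x z (pairingCoords ω x z u)
  have hvy : ω v y = ω v u := by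
    obtain ⟨hvz, hvx⟩ := pairingCoords_eq_zero_iff.1 hv
    simp [y, apply_hyperbolicSum, hvz, hvx]
  refine ⟨_, _, h.snoc hω hv (v := (ω v u)⁻¹ • y) ?_ ?_⟩
  · rw [map_smul, h.pairingCoords_sub_hyperbolicSum hω, smul_zero]
  · rw [map_smul, hvy, smul_eq_mul, inv_mul_cancel₀ hvu]

theorem finrank_eq {m : ℕ} {x z : Fin m → V} [FiniteDimensional k V] (h : IsHyperbolic ω x z)
    (hω : ω.IsAlt) (hrad : LinearMap.ker (pairingCoords ω x z) ≤ LinearMap.ker ω) :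
    Module.finrank k V = Module.finrank k (LinearMap.ker ω) + 2 * m := by
  have hker : LinearMap.ker (pairingCoords ω x z) = LinearMap.ker ω := by
    refine hrad.antisymm fun v hv => pairingCoords_eq_zero_iff.2 ?_
    simp [LinearMap.mem_ker.1 hv]
  have hrank := (pairingCoords ω x z).finrank_range_add_finrank_ker
  rw [hker, LinearMap.range_eq_top.2 (h.surjective_pairingCoords hω), finrank_top,
    Module.finrank_prod, Module.finrank_fin_fun] at hrank
  omega

end IsHyperbolic

theorem exists_isHyperbolic_ker_le [FiniteDimensional k V] (hω : ω.IsAlt) :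
    ∃ (m : ℕ) (x z : Fin m → V), IsHyperbolic ω x z ∧
      LinearMap.ker (pairingCoords ω x z) ≤ LinearMap.ker ω := by
  classical
  let P : ℕ → Prop := fun m => ∃ x z : Fin m → V, IsHyperbolic ω x z
  have le_of_P {m : ℕ} : P m → m ≤ Module.finrank k V := fun ⟨_, _, h⟩ => h.card_le_finrank hω
  have hP : P (Nat.findGreatest P (Module.finrank k V)) :=
    Nat.findGreatest_spec (Nat.zero_le _)
      ⟨Fin.elim0, Fin.elim0, fun i => i.elim0, fun i => i.elim0, fun i => i.elim0⟩
  obtain ⟨x, z, h⟩ := hP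
  refine ⟨_, x, z, h, fun v hv => LinearMap.ext fun u => ?_⟩
  by_contra hvu
  have hsucc : P _ := h.exists_succ hω hv hvu
  exact (Nat.le_findGreatest (le_of_P hsucc) hsucc).not_gt (Nat.lt_succ_self _)

/-- The families `x` and `z` are hyperbolic and form a basis of the subspace `U` modulo its
radical. -/
structure IsHyperbolicBasis {ι : Type*} [Fintype ι] [DecidableEq ι] (ω : LinearMap.BilinForm k V)
    (U : Submodule k V) (x z : ι → V) : Prop extends IsHyperbolic ω x z where
  x_mem : ∀ i, x i ∈ U
  z_mem : ∀ i, z i ∈ U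
  sub_mem : ∀ v ∈ U, v - hyperbolicSum x z (pairingCoords ω x z v) ∈ U ⊓ ω.orthogonal U

theorem exists_isHyperbolicBasis [FiniteDimensional k V] (hω : ω.IsAlt) (U : Submodule k V) {m : ℕ}
    (hm : Module.finrank k U = Module.finrank k ↥(U ⊓ ω.orthogonal U) + 2 * m) :
    ∃ x z : Fin m → V, IsHyperbolicBasis ω U x z := by
  have halt : (ω.restrict U).IsAlt := fun u => hω u
  obtain ⟨m', x, z, h, hrad⟩ := exists_isHyperbolic_ker_le halt
  have hker : (LinearMap.ker (ω.restrict U)).map U.subtype = U ⊓ ω.orthogonal U := by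
    refine le_antisymm ?_ (LinearMap.BilinForm.inf_orthogonal_self_le_ker_restrict hω.isRefl)
    rintro _ ⟨u, hu, rfl⟩
    exact ⟨u.2, fun v hv => hω.isRefl _ _ (LinearMap.congr_fun hu ⟨v, hv⟩)⟩
  obtain rfl : m' = m := by
    have := h.finrank_eq halt hrad
    rw [← hker, Submodule.finrank_map_subtype_eq] at hm
    omega
  refine ⟨fun i => x i, fun i => z i, ⟨h.xx, h.zz, h.xz⟩, fun i => (x i).2, fun i => (z i).2,
    fun v hv => ?_⟩
  rw [← hker]
  exact ⟨_, hrad (h.pairingCoords_sub_hyperbolicSum halt ⟨v, hv⟩),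
    by simp [hyperbolicSum, pairingCoords_apply]⟩

theorem exists_symplectic_coordinates [FiniteDimensional k V] (hω : ω.IsAlt)
    (hnd : ω.Nondegenerate) (hV : Module.finrank k V = 2) :
    ∃ a b : V →ₗ[k] k, (∀ u v, ω u v = b u * a v - b v * a u) ∧
      ∀ u, a u = 0 → b u = 0 → u = 0 := by
  obtain ⟨m, x, z, h, hrad⟩ := exists_isHyperbolic_ker_le hω
  have hker : LinearMap.ker ω = ⊥ := hnd.ker_eq_bot
  obtain rfl : m = 1 := by
    have := h.finrank_eq hω hrad
    rw [hker, finrank_bot, hV] at this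
    omega
  have eq_sum (u) : u = hyperbolicSum x z (pairingCoords ω x z u) := by
    rw [← sub_eq_zero, ← Submodule.mem_bot k, ← hker]
    exact hrad (h.pairingCoords_sub_hyperbolicSum hω u)
  refine ⟨ω.flip (z 0), ω.flip (x 0), fun u v => ?_, fun u ha hb => ?_⟩
  · conv_lhs => rw [eq_sum v, apply_hyperbolicSum]
    simp [pairingCoords_apply, mul_comm]
  · have hcoords : pairingCoords ω x z u = 0 := pairingCoords_eq_zero_iff.2
      ⟨Fin.forall_fin_one.2 ha, Fin.forall_fin_one.2 hb⟩
    rw [eq_sum u, hcoords]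
    simp [hyperbolicSum]

end Hyperbolic

/-! ### Weyl operators and stabilizer states -/

open scoped Matrix

section AdditiveCharacter

variable {k : Type*} [Field k] {ψ : AddChar k ℂ}

theorem exists_addChar_mul_ne_one (hψ : ψ ≠ 1) {a : k} (ha : a ≠ 0) : ∃ t, ψ (t * a) ≠ 1 := by
  by_contra! h
  refine AddChar.IsPrimitive.of_ne_one hψ ha ?_
  ext t
  rw [AddChar.mulShift_apply, mul_comm, h, AddChar.one_apply]

theorem addChar_ne_zero (a : k) : ψ a ≠ 0 := (ψ.val_isUnit a).ne_zero

theorem sum_addChar_comp_eq_zero {Y : Type*} [AddCommGroup Y] [Module k Y] [Fintype Y]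
    (hψ : ψ ≠ 1) {f : Y →ₗ[k] k} (hf : f ≠ 0) : ∑ y, ψ (f y) = 0 := by
  obtain ⟨t, ht⟩ := AddChar.ne_one_iff.1 hψ
  obtain ⟨y, rfl⟩ := LinearMap.surjective hf t
  refine AddChar.sum_eq_zero_of_ne_one (ψ := ψ.compAddMonoidHom f.toAddMonoidHom) ?_
  exact AddChar.ne_one_iff.2 ⟨y, ht⟩

end AdditiveCharacter

/-- A projective representation of `G` by unitary matrices of trace zero off the identity, whose
commutation relations are given by the form `ω` through the character `ψ`: the Weyl operators of a
system with basis states `I`. The phases are normalized so that they form the cocycle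
`ψ (ω u v / 2)`. -/
structure WeylSystem {k G : Type*} [Field k] [AddCommGroup G] [Module k G] (ψ : AddChar k ℂ)
    (ω : LinearMap.BilinForm k G) (I : Type*) [Fintype I] [DecidableEq I] where
  op : G → Matrix I I ℂ
  op_zero : op 0 = 1
  op_mul : ∀ u v, op u * op v = ψ (2⁻¹ * ω u v) • op (u + v)
  op_adj : ∀ u, (op u).conjTranspose = op (-u)
  op_trace : ∀ u, u ≠ 0 → (op u).trace = 0

namespace WeylSystem

variable {k G : Type*} [Field k] [AddCommGroup G] [Module k G] {ψ : AddChar k ℂ}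
  {ω : LinearMap.BilinForm k G} {I : Type*} [Fintype I] [DecidableEq I] (W : WeylSystem ψ ω I)

/-- The Weyl system obtained by renaming the basis states. -/
def reindex {J : Type*} [Fintype J] [DecidableEq J] (e : J ≃ I) : WeylSystem ψ ω J where
  op u := (W.op u).submatrix e e
  op_zero := by rw [W.op_zero, Matrix.submatrix_one_equiv]
  op_mul u v := by rw [Matrix.submatrix_mul_equiv, W.op_mul, Matrix.submatrix_smul]; rfl
  op_adj u := by rw [Matrix.conjTranspose_submatrix, W.op_adj]
  op_trace u hu := by
    rw [← W.op_trace u hu]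
    exact Equiv.sum_comp e fun i => W.op u i i

theorem op_mul_of_eq_zero {u v : G} (huv : ω u v = 0) : W.op u * W.op v = W.op (u + v) := by
  rw [W.op_mul, huv, mul_zero, AddChar.map_zero_eq_one, one_smul]

theorem op_neg_mul_op (hω : ω.IsAlt) (u : G) : W.op (-u) * W.op u = 1 := by
  rw [W.op_mul_of_eq_zero (by simp [hω.self_eq_zero]), neg_add_cancel, W.op_zero]

theorem conj_op [NeZero (2 : k)] (hω : ω.IsAlt) (u v : G) :
    W.op (-u) * W.op v * W.op u = ψ (ω v u) • W.op v := by
  rw [W.op_mul, Matrix.smul_mul, W.op_mul, smul_smul, ← AddChar.map_add_eq_mul,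
    neg_add_eq_sub, sub_add_cancel]
  congr 2
  simp only [map_neg, map_sub, LinearMap.neg_apply, LinearMap.sub_apply, hω.self_eq_zero,
    hω.neg_eq]
  linear_combination ω v u * inv_mul_cancel₀ (two_ne_zero' k)

theorem op_mul_op_neg_mul_op {x x' : G} (hω : ω.IsAlt) (hxx' : ω x x' = 0) (w : G) :
    W.op (-x) * W.op w * W.op x' = ψ (2⁻¹ * (ω w x + ω w x')) • W.op (w + (x' - x)) := by
  rw [W.op_mul, Matrix.smul_mul, W.op_mul, smul_smul, ← AddChar.map_add_eq_mul]
  congr 2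
  · simp only [map_add, LinearMap.add_apply, map_neg, LinearMap.neg_apply, hxx', hω.neg_eq]
    ring
  · abel

section Basis

variable [Nonempty I]

theorem linearIndependent_op [Finite G] (hω : ω.IsAlt) : LinearIndependent ℂ W.op := by
  classical
  have := Fintype.ofFinite G
  refine Fintype.linearIndependent_iff.2 fun f hf u => ?_
  have trace_eq (v : G) :
      (W.op (-u) * (f v • W.op v)).trace = if v = u then f v * Fintype.card I else 0 := by
    split_ifs with hvu
    · rw [hvu, Matrix.mul_smul, W.op_neg_mul_op hω, Matrix.trace_smul, Matrix.trace_one,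
        smul_eq_mul]
    · rw [Matrix.mul_smul, W.op_mul, Matrix.trace_smul, Matrix.trace_smul,
        W.op_trace _ (by rwa [neg_add_eq_sub, sub_ne_zero]), smul_zero, smul_zero]
  have h := congrArg (fun E => (W.op (-u) * E).trace) hf
  simp only [Finset.mul_sum, Matrix.trace_sum, trace_eq, Finset.sum_ite_eq', Finset.mem_univ,
    if_true, mul_zero, Matrix.trace_zero] at h
  exact (mul_eq_zero.1 h).resolve_right (Nat.cast_ne_zero.2 Fintype.card_ne_zero)

variable [Fintype G]

theorem exists_eq_sum (hω : ω.IsAlt) (hcard : Fintype.card G = Fintype.card I ^ 2)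
    (E : Matrix I I ℂ) : ∃ f : G → ℂ, ∑ v, f v • W.op v = E := by
  refine (Submodule.mem_span_range_iff_exists_fun ℂ).1 ?_
  rw [(W.linearIndependent_op hω).span_eq_top_of_card_eq_finrank' (by
    rw [hcard, Module.finrank_matrix, Module.finrank_self, mul_one, sq])]
  exact Submodule.mem_top

theorem coeff_eq_zero_of_commute [NeZero (2 : k)] (hω : ω.IsAlt) {f : G → ℂ} {u v : G}
    (hcomm : Commute (∑ v, f v • W.op v) (W.op u)) (hvu : ψ (ω v u) ≠ 1) : f v = 0 := by
  have hconj : W.op (-u) * (∑ v, f v • W.op v) * W.op u = ∑ v, f v • W.op v := by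
    rw [mul_assoc, hcomm.eq, ← mul_assoc, W.op_neg_mul_op hω, one_mul]
  have hzero : ∑ v, (f v * (ψ (ω v u) - 1)) • W.op v = 0 := by
    rw [← sub_eq_zero.2 hconj, Finset.mul_sum, Finset.sum_mul, ← Finset.sum_sub_distrib]
    refine Finset.sum_congr rfl fun v _ => ?_
    rw [Matrix.mul_smul, Matrix.smul_mul, W.conj_op hω, smul_smul, ← sub_smul, mul_sub, mul_one]
  have := Fintype.linearIndependent_iff.1 (W.linearIndependent_op hω) _ hzero v
  exact (mul_eq_zero.1 this).resolve_right (sub_ne_zero.2 hvu)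

end Basis

end WeylSystem

section StabilizerState

variable {I : Type*} [Fintype I]

theorem exists_smul_star_dotProduct_self_eq_one {φ : I → ℂ} (hφ : φ ≠ 0) :
    ∃ t : ℂ, star (t • φ) ⬝ᵥ (t • φ) = 1 := by
  set φ' : EuclideanSpace ℂ I := WithLp.toLp 2 φ
  have hφ' : φ' ≠ 0 := fun h => hφ (congrArg WithLp.ofLp h)
  refine ⟨(‖φ'‖ : ℂ)⁻¹, ?_⟩
  have hnorm : ‖((‖φ'‖ : ℂ)⁻¹ • φ')‖ = 1 := norm_smul_inv_norm hφ'
  have h := inner_self_eq_norm_sq_to_K (𝕜 := ℂ) ((‖φ'‖ : ℂ)⁻¹ • φ')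
  rw [hnorm, EuclideanSpace.inner_eq_star_dotProduct, dotProduct_comm] at h
  simpa using h

namespace WeylSystem

variable {k G : Type*} [Field k] [AddCommGroup G] [Module k G] {ψ : AddChar k ℂ}
  {ω : LinearMap.BilinForm k G} [DecidableEq I] (W : WeylSystem ψ ω I)

theorem exists_ne_zero_fixed [Finite G] [Nonempty I] {Z : Submodule k G}
    (hZ : Z ≤ ω.orthogonal Z) : ∃ φ : I → ℂ, φ ≠ 0 ∧ ∀ z ∈ Z, W.op z *ᵥ φ = φ := by
  have := Fintype.ofFinite Z
  set P : Matrix I I ℂ := ∑ z : Z, W.op z with hP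
  have hfix (z : Z) : W.op z * P = P := by
    rw [hP, Finset.mul_sum, ← Equiv.sum_comp (Equiv.addLeft z) fun z : Z => W.op z]
    exact Finset.sum_congr rfl fun z' _ => W.op_mul_of_eq_zero (hZ z'.2 z z.2)
  have htrace : P.trace = Fintype.card I := by
    rw [hP, Matrix.trace_sum, Finset.sum_eq_single 0]
    · rw [Submodule.coe_zero, W.op_zero, Matrix.trace_one]
    · exact fun z _ hz => W.op_trace z (by simpa using hz)
    · simp
  have hP0 : P ≠ 0 := by
    intro h
    rw [h, Matrix.trace_zero] at htrace
    exact Nat.cast_ne_zero.2 Fintype.card_ne_zero htrace.symm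
  obtain ⟨j, hj⟩ : ∃ j, P.col j ≠ 0 := by
    by_contra! h
    exact hP0 (Matrix.ext fun i j => congrFun (h j) i)
  exact ⟨P.col j, hj, fun z hz => congrArg (fun M => Matrix.col M j) (hfix ⟨z, hz⟩)⟩

/-- A unit vector in the joint fixed space of the Weyl operators of `Z`. -/
structure IsStabilizerState (Z : Submodule k G) (φ : I → ℂ) : Prop where
  unit : star φ ⬝ᵥ φ = 1
  fixed : ∀ z ∈ Z, W.op z *ᵥ φ = φ

theorem exists_isStabilizerState [Finite G] [Nonempty I] {Z : Submodule k G}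
    (hZ : Z ≤ ω.orthogonal Z) : ∃ φ, W.IsStabilizerState Z φ := by
  obtain ⟨φ, hφ0, hφ⟩ := W.exists_ne_zero_fixed hZ
  obtain ⟨t, ht⟩ := exists_smul_star_dotProduct_self_eq_one hφ0
  exact ⟨t • φ, ht, fun z hz => by rw [Matrix.mulVec_smul, hφ z hz]⟩

theorem star_op_mulVec (φ : I → ℂ) (u : G) : star (W.op u *ᵥ φ) = star φ ᵥ* W.op (-u) := by
  rw [Matrix.star_mulVec, W.op_adj]

/-- The expectation value of the Weyl operator of `u` in the state `φ`. -/
def expect (φ : I → ℂ) (u : G) : ℂ := star φ ⬝ᵥ (W.op u *ᵥ φ)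

theorem star_op_mulVec_dotProduct (hω : ω.IsAlt) (φ : I → ℂ) {x x' : G} (hxx' : ω x x' = 0)
    (w : G) : star (W.op x *ᵥ φ) ⬝ᵥ (W.op w *ᵥ (W.op x' *ᵥ φ)) =
      ψ (2⁻¹ * (ω w x + ω w x')) * W.expect φ (w + (x' - x)) := by
  rw [star_op_mulVec, ← Matrix.dotProduct_mulVec, Matrix.mulVec_mulVec, Matrix.mulVec_mulVec,
    W.op_mul_op_neg_mul_op hω hxx', Matrix.smul_mulVec, dotProduct_smul, smul_eq_mul, expect]

variable {W} {Z : Submodule k G} {φ : I → ℂ}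

theorem IsStabilizerState.expect_eq_one (hφ : W.IsStabilizerState Z φ) {z : G} (hz : z ∈ Z) :
    W.expect φ z = 1 := by
  rw [expect, hφ.fixed z hz, hφ.unit]

theorem IsStabilizerState.expect_eq_zero [NeZero (2 : k)] (hφ : W.IsStabilizerState Z φ)
    (hψ : ψ ≠ 1) (hω : ω.IsAlt) {z u : G} (hz : z ∈ Z) (hzu : ω z u ≠ 0) :
    W.expect φ u = 0 := by
  obtain ⟨t, ht⟩ := exists_addChar_mul_ne_one hψ (hω.isRefl.eq_iff.not.1 hzu)
  have hconj : W.expect φ u = ψ (t * ω u z) * W.expect φ u := by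
    calc W.expect φ u
        = star (W.op (t • z) *ᵥ φ) ⬝ᵥ (W.op u *ᵥ (W.op (t • z) *ᵥ φ)) := by
          rw [hφ.fixed _ (Z.smul_mem t hz), expect]
      _ = ψ (t * ω u z) * W.expect φ u := by
          rw [W.star_op_mulVec, ← Matrix.dotProduct_mulVec, Matrix.mulVec_mulVec,
            Matrix.mulVec_mulVec, W.conj_op hω, Matrix.smul_mulVec, dotProduct_smul, smul_eq_mul,
            map_smul, smul_eq_mul, expect]
  by_contra h
  exact ht ((mul_eq_right₀ h).1 hconj.symm)

end WeylSystem

end StabilizerState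

section Schroedinger

variable {k G ι : Type*} [Field k] [Fintype k] [DecidableEq k] [AddCommGroup G] [Module k G]
  [Fintype ι] {ψ : AddChar k ℂ} {ω : LinearMap.BilinForm k G}

/-- The operator on functions of `ι → k` that multiplies by the character `b u` and shifts by
`a u`, with the phase that makes its inverse the operator of `-u`. -/
noncomputable def schroedingerOp (ψ : AddChar k ℂ) (a b : G →ₗ[k] ι → k) (u : G) :
    Matrix (ι → k) (ι → k) ℂ :=
  fun y y' => if y = y' + a u then ψ (b u ⬝ᵥ y' + 2⁻¹ * (b u ⬝ᵥ a u)) else 0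

theorem schroedingerOp_mul_apply [DecidableEq ι] (a b : G →ₗ[k] ι → k)
    (M : Matrix (ι → k) (ι → k) ℂ) (u : G) (y y' : ι → k) : (M * schroedingerOp ψ a b u) y y' =
      M y (y' + a u) * ψ (b u ⬝ᵥ y' + 2⁻¹ * (b u ⬝ᵥ a u)) := by
  simp [Matrix.mul_apply, schroedingerOp]

theorem trace_schroedingerOp [DecidableEq ι] (hψ : ψ ≠ 1) (a b : G →ₗ[k] ι → k) {u : G}
    (hu : a u = 0 → b u ≠ 0) : (schroedingerOp ψ a b u).trace = 0 := by
  by_cases ha : a u = 0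
  · have hb : dotProductBilin k k (b u) ≠ 0 := by
      refine fun h => hu ha (dotProduct_eq_zero _ fun y => ?_)
      exact LinearMap.congr_fun h y
    simpa [Matrix.trace, schroedingerOp, ha] using sum_addChar_comp_eq_zero hψ hb
  · simp [Matrix.trace, schroedingerOp, ha]

/-- The Schrödinger representation of `G`, whose elements act by a shift and a character with
components `a` and `b`. -/
noncomputable def schroedingerSystem [DecidableEq ι] [NeZero (2 : k)] (hψ : ψ ≠ 1)
    (a b : G →ₗ[k] ι → k) (hω : ∀ u v, ω u v = b u ⬝ᵥ a v - b v ⬝ᵥ a u)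
    (h0 : ∀ u, a u = 0 → b u = 0 → u = 0) :
    WeylSystem ψ ω (ι → k) where
  op := schroedingerOp ψ a b
  op_zero := by
    ext y y'
    simp [schroedingerOp, Matrix.one_apply]
  op_mul u v := by
    ext y y'
    have hshift : y' + a v + a u = y' + a (u + v) := by rw [map_add]; abel
    rw [schroedingerOp_mul_apply, Matrix.smul_apply, smul_eq_mul]
    unfold schroedingerOp
    rw [hshift]
    split_ifs
    · rw [← AddChar.map_add_eq_mul, ← AddChar.map_add_eq_mul, hω]
      congr 1
      simp only [map_add, add_dotProduct, dotProduct_add]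
      linear_combination -(b u ⬝ᵥ a v) * inv_mul_cancel₀ (two_ne_zero' k)
    · rw [zero_mul, mul_zero]
  op_adj u := by
    ext y y'
    have hshift : y' = y + a u ↔ y = y' + a (-u) := by
      rw [map_neg, ← sub_eq_add_neg, eq_sub_iff_add_eq, eq_comm]
    rw [Matrix.conjTranspose_apply]
    unfold schroedingerOp
    by_cases h : y' = y + a u
    · rw [if_pos h, if_pos (hshift.1 h), ← starRingEnd_apply, ← AddChar.map_neg_eq_conj, h]
      congr 1
      simp only [map_neg, dotProduct_add, dotProduct_neg, neg_dotProduct]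
      linear_combination -(b u ⬝ᵥ a u) * inv_mul_cancel₀ (two_ne_zero' k)
    · rw [if_neg h, if_neg (hshift.not.1 h), star_zero]
  op_trace u hu := trace_schroedingerOp hψ a b fun ha hb => hu (h0 u ha hb)

end Schroedinger

section LocalOperators

variable {q n : ℕ} {S T : Finset (Fin n)} {E E' : Matrix (Fin n → Fin q) (Fin n → Fin q) ℂ}

theorem actsOn_of_forall [NeZero q] (hoff : ∀ x y, E x y ≠ 0 → ∀ i, i ∉ S → x i = y i)
    (hon : ∀ x y x' y', (∀ i ∈ S, x i = x' i ∧ y i = y' i) →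
      (∀ i, i ∉ S → x i = y i ∧ x' i = y' i) → E x y = E x' y') : ActsOn S E := by
  let extend (s : S → Fin q) (i : Fin n) : Fin q := if h : i ∈ S then s ⟨i, h⟩ else 0
  refine ⟨fun s t => E (extend s) (extend t), fun x y => ⟨fun hxy => hon _ _ _ _ ?_ ?_,
    fun hxy => by_contra fun hE => hxy (hoff x y hE)⟩⟩
  · intro i hi
    simp [extend, hi]
  · intro i hi
    simp [extend, hi, hxy i hi]

theorem ActsOn.apply_eq_zero (hE : ActsOn S E) {x y : Fin n → Fin q} {i : Fin n} (hi : i ∉ S)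
    (hxy : x i ≠ y i) : E x y = 0 := by
  obtain ⟨e, he⟩ := hE
  exact (he x y).2 fun h => hxy (h i hi)

theorem ActsOn.apply_congr (hE : ActsOn S E) {x y x' y' : Fin n → Fin q}
    (hS : ∀ i ∈ S, x i = x' i ∧ y i = y' i) (h : ∀ i, i ∉ S → x i = y i)
    (h' : ∀ i, i ∉ S → x' i = y' i) : E x y = E x' y' := by
  obtain ⟨e, he⟩ := hE
  rw [(he x y).1 h, (he x' y').1 h']
  congr 1 <;> ext i
  exacts [congrArg _ (hS i i.2).1, congrArg _ (hS i i.2).2]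

theorem ActsOn.mul_apply (hE : ActsOn S E) (hE' : ActsOn T E') (hST : Disjoint S T)
    (x y : Fin n → Fin q) : (E * E') x y = E x (S.piecewise y x) * E' (S.piecewise y x) y := by
  rw [Matrix.mul_apply]
  refine Finset.sum_eq_single _ (fun z _ hz => ?_) (by simp)
  obtain ⟨i, hi⟩ := Function.ne_iff.1 hz
  by_cases hiS : i ∈ S
  · rw [Finset.piecewise_eq_of_mem _ _ _ hiS] at hi
    rw [hE'.apply_eq_zero (Finset.disjoint_left.1 hST hiS) hi, mul_zero]
  · rw [Finset.piecewise_eq_of_notMem _ _ _ hiS] at hi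
    rw [hE.apply_eq_zero hiS hi.symm, zero_mul]

theorem ActsOn.commute (hE : ActsOn S E) (hE' : ActsOn T E') (hST : Disjoint S T) :
    Commute E E' := by
  ext x y
  rw [hE.mul_apply hE' hST, hE'.mul_apply hE hST.symm, mul_comm]
  have hT {i} (hi : i ∈ T) : i ∉ S := Finset.disjoint_right.1 hST hi
  by_cases hxy : ∀ i, i ∉ S → i ∉ T → x i = y i
  · congr 1
    · refine hE'.apply_congr ?_ ?_ ?_ <;> intro i hi <;> by_cases hiS : i ∈ S <;>
        simp_all [Finset.piecewise]
    · refine hE.apply_congr ?_ ?_ ?_ <;> intro i hi <;> by_cases hiT : i ∈ T <;>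
        simp_all [Finset.piecewise]
  · push Not at hxy
    obtain ⟨i, hiS, hiT, hi⟩ := hxy
    rw [hE'.apply_eq_zero (x := S.piecewise y x) hiT (by simpa [hiS] using hi),
      hE.apply_eq_zero (x := T.piecewise y x) hiS (by simpa [hiT] using hi), zero_mul, mul_zero]

end LocalOperators

section PiForm

variable {k F ι : Type*} [Field k] [AddCommGroup F] [Module k F] [Fintype ι]
  {τ : LinearMap.BilinForm k F}

/-- The form on `ι → F` that adds up the values of the form `τ` in all coordinates. -/
def piForm (ι : Type*) [Fintype ι] (τ : LinearMap.BilinForm k F) :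
    LinearMap.BilinForm k (ι → F) :=
  ∑ i, τ.compl₁₂ (LinearMap.proj i) (LinearMap.proj i)

theorem piForm_apply (u v : ι → F) : piForm ι τ u v = ∑ i, τ (u i) (v i) := by
  simp [piForm]

theorem piForm_single [DecidableEq ι] (u : ι → F) (i : ι) (x : F) :
    piForm ι τ u (Pi.single i x) = τ (u i) x := by
  rw [piForm_apply, Finset.sum_eq_single i]
  · rw [Pi.single_eq_same]
  · intro j _ hj
    rw [Pi.single_eq_of_ne hj, map_zero]
  · simp

theorem piForm_isAlt (hτ : τ.IsAlt) : (piForm ι τ).IsAlt := fun u => by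
  simp [piForm_apply, hτ.self_eq_zero]

theorem piForm_nondegenerate (hτ : τ.IsAlt) (hnd : τ.Nondegenerate) :
    (piForm ι τ).Nondegenerate := by
  classical
  refine (piForm_isAlt hτ).isRefl.nondegenerate_iff_separatingLeft.2 fun u hu => ?_
  exact funext fun i => hnd.1 _ fun x => by rw [← piForm_single u i x, hu]

end PiForm

namespace WeylSystem

variable {k F : Type*} [Field k] [AddCommGroup F] [Module k F] {ψ : AddChar k ℂ}
  {τ : LinearMap.BilinForm k F} {q n : ℕ}

/-- The Weyl operators on `n` qudits are local: the operator of a word acts only on the qudits in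
the support of the word. -/
def IsLocal (W : WeylSystem ψ (piForm (Fin n) τ) (Fin n → Fin q)) : Prop :=
  ∀ (S : Finset (Fin n)) (w : Fin n → F), (∀ i, i ∉ S → w i = 0) → ActsOn S (W.op w)

theorem isLocal_reindex_schroedingerSystem [Fintype k] [DecidableEq k] [NeZero (2 : k)] [NeZero q]
    (hψ : ψ ≠ 1) (a b : F →ₗ[k] k)
    (hω : ∀ u v, piForm (Fin n) τ u v = b.compLeft (Fin n) u ⬝ᵥ a.compLeft (Fin n) v -
      b.compLeft (Fin n) v ⬝ᵥ a.compLeft (Fin n) u)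
    (h0 : ∀ u, a.compLeft (Fin n) u = 0 → b.compLeft (Fin n) u = 0 → u = 0) (e : Fin q ≃ k) :
    ((schroedingerSystem hψ (a.compLeft (Fin n)) (b.compLeft (Fin n)) hω h0).reindex
      (Equiv.piCongrRight fun _ => e)).IsLocal := by
  intro S w hw
  have op_apply (x y : Fin n → Fin q) : ((schroedingerSystem hψ _ _ hω h0).reindex
      (Equiv.piCongrRight fun _ => e)).op w x y = if ∀ i, e (x i) = e (y i) + a (w i) then
        ψ (∑ i, b (w i) * e (y i) + 2⁻¹ * (b.compLeft (Fin n) w ⬝ᵥ a.compLeft (Fin n) w))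
      else 0 := if_congr funext_iff rfl rfl
  refine actsOn_of_forall (fun x y hxy i hi => ?_) fun x y x' y' hS hoff => ?_
  · rw [op_apply, ne_eq, ite_eq_right_iff, Classical.not_imp] at hxy
    simpa [hw i hi] using hxy.1 i
  · have hshift : (∀ i, e (x i) = e (y i) + a (w i)) ↔ ∀ i, e (x' i) = e (y' i) + a (w i) := by
      refine forall_congr' fun i => ?_
      by_cases hi : i ∈ S
      · rw [(hS i hi).1, (hS i hi).2]
      · simp [hw i hi, hoff i hi]
    have hphase : ∑ i, b (w i) * e (y i) = ∑ i, b (w i) * e (y' i) := by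
      refine Finset.sum_congr rfl fun i _ => ?_
      by_cases hi : i ∈ S
      · rw [(hS i hi).2]
      · simp [hw i hi]
    simp only [op_apply, hshift, hphase]

theorem exists_isLocal [Finite k] [NeZero (2 : k)] (hψ : ψ ≠ 1) (hτ : τ.IsAlt)
    (hnd : τ.Nondegenerate) (hF : Module.finrank k F = 2) (hq : Nat.card k = q) (n : ℕ) :
    ∃ W : WeylSystem ψ (piForm (Fin n) τ) (Fin n → Fin q), W.IsLocal := by
  classical
  have := Fintype.ofFinite k
  have : FiniteDimensional k F := .of_finrank_eq_succ hF
  have : NeZero q := ⟨hq ▸ Nat.card_pos.ne'⟩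
  obtain ⟨a, b, hab, h0⟩ := exists_symplectic_coordinates hτ hnd hF
  have hω (u v) : piForm (Fin n) τ u v = b.compLeft (Fin n) u ⬝ᵥ a.compLeft (Fin n) v -
      b.compLeft (Fin n) v ⬝ᵥ a.compLeft (Fin n) u := by
    simp only [piForm_apply, hab, Finset.sum_sub_distrib]
    rfl
  exact ⟨_, isLocal_reindex_schroedingerSystem hψ a b hω
    (fun u ha hb => funext fun i => h0 _ (congrFun ha i) (congrFun hb i))
    (Finite.equivFinOfCardEq hq).symm⟩

theorem IsLocal.exists_eq_sum_of_actsOn [Fintype F] [NeZero (2 : k)] [NeZero q]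
    {W : WeylSystem ψ (piForm (Fin n) τ) (Fin n → Fin q)} (hW : W.IsLocal) (hψ : ψ ≠ 1)
    (hτ : τ.IsAlt) (hnd : τ.Nondegenerate) (hF : Fintype.card F = q ^ 2) {S : Finset (Fin n)}
    {E : Matrix (Fin n → Fin q) (Fin n → Fin q) ℂ} (hE : ActsOn S E) :
    ∃ f : (Fin n → F) → ℂ, (∀ w, f w ≠ 0 → ∀ i, i ∉ S → w i = 0) ∧ ∑ w, f w • W.op w = E := by
  have hω := piForm_isAlt (ι := Fin n) hτ
  obtain ⟨f, rfl⟩ := W.exists_eq_sum hω (by simp [hF, ← pow_mul, mul_comm]) E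
  refine ⟨f, fun w hfw i hi => by_contra fun hwi => hfw ?_, rfl⟩
  obtain ⟨x, hx⟩ : ∃ x, τ (w i) x ≠ 0 := by
    by_contra! h
    exact hwi (hnd.1 _ h)
  obtain ⟨t, ht⟩ := exists_addChar_mul_ne_one hψ hx
  have hcomm := hE.commute (hW {i} (Pi.single i (t • x)) fun j hj =>
    Pi.single_eq_of_ne (by simpa using hj) _) (Finset.disjoint_singleton_right.2 hi)
  exact W.coeff_eq_zero_of_commute hω hcomm (by rwa [piForm_single, map_smul])

end WeylSystem

/-! ### Stabilizer codes with entanglement assistance -/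

section Compression

variable {q n m c : ℕ} (Q : EACode q n m c)

/-- The compression of the operator `E ⊗ 1` to the code; `E` is detected when it is a scalar. -/
noncomputable def EACode.compress : Matrix (Fin n → Fin q) (Fin n → Fin q) ℂ →ₗ[ℂ]
    Matrix (Fin m → Fin q) (Fin m → Fin q) ℂ where
  toFun E :=
    Q.encodeᴴ * Matrix.kronecker E (1 : Matrix (Fin c → Fin q) (Fin c → Fin q) ℂ) * Q.encode
  map_add' E E' := by rw [Matrix.kronecker, Matrix.add_kronecker, Matrix.mul_add, Matrix.add_mul]
  map_smul' t E := by
    rw [Matrix.kronecker, Matrix.smul_kronecker, Matrix.mul_smul, Matrix.smul_mul]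
    rfl

theorem EACode.compress_apply (E : Matrix (Fin n → Fin q) (Fin n → Fin q) ℂ)
    (x x' : Fin m → Fin q) : Q.compress E x x' =
      ((q : ℂ) ^ c)⁻¹ * ∑ b, (Q.encoderᴴ * E * Q.encoder) (x, b) (x', b) := by
  have hsqrt : (((√((q : ℝ) ^ c))⁻¹ : ℝ) : ℂ) * (((√((q : ℝ) ^ c))⁻¹ : ℝ) : ℂ) =
      ((q : ℂ) ^ c)⁻¹ := by
    rw [← Complex.ofReal_mul, ← mul_inv, Real.mul_self_sqrt (by positivity)]
    push_cast
    rfl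
  simp only [EACode.compress, LinearMap.coe_mk, AddHom.coe_mk, Matrix.mul_apply,
    Matrix.conjTranspose_apply, EACode.encode, Fintype.sum_prod_type, Matrix.kronecker,
    Matrix.kroneckerMap_apply, Matrix.one_apply, mul_ite, mul_one, mul_zero, Finset.sum_ite_eq',
    Finset.mem_univ, if_true, ← hsqrt, Finset.mul_sum, Finset.sum_mul, star_mul',
    RCLike.star_def, Complex.conj_ofReal]
  rw [Finset.sum_comm]
  refine Finset.sum_congr rfl fun b _ => Finset.sum_congr rfl fun y _ =>
    Finset.sum_congr rfl fun y' _ => ?_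
  ring

theorem EACode.Detects.sum {Q : EACode q n m c} {ι : Type*} [Fintype ι] {f : ι → ℂ}
    {E : ι → Matrix (Fin n → Fin q) (Fin n → Fin q) ℂ}
    (h : ∀ i, f i ≠ 0 → Q.Detects (E i)) : Q.Detects (∑ i, f i • E i) := by
  have detects_iff (E) : Q.Detects E ↔
        Q.compress E ∈ ℂ ∙ (1 : Matrix (Fin m → Fin q) (Fin m → Fin q) ℂ) := by
    rw [Submodule.mem_span_singleton]
    exact exists_congr fun z => eq_comm
  rw [detects_iff, map_sum]
  refine Submodule.sum_mem _ fun i _ => ?_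
  rw [map_smul]
  by_cases hf : f i = 0
  · rw [hf, zero_smul]
    exact Submodule.zero_mem _
  · exact Submodule.smul_mem _ _ ((detects_iff _).1 (h i hf))

end Compression

/-- The data that make a stabilizer state into an entanglement-assisted code: an isotropic space
`Z` of stabilizers, and commuting shift operators `X` for the messages in `A` and the states in `B`
of the sender's halves of the entangled pairs, which are told apart by their commutation relations
with `Z`. -/
structure LogicalFrame {k G : Type*} [Field k] [AddCommGroup G] [Module k G]
    (ω : LinearMap.BilinForm k G) (A B : Type*) [AddCommGroup A] [Module k A] [AddCommGroup B]
    [Module k B] where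
  Z : Submodule k G
  X : A × B →ₗ[k] G
  isotropic : Z ≤ ω.orthogonal Z
  commute : ∀ u v, ω (X u) (X v) = 0
  separating : ∀ u ≠ 0, ∃ z ∈ Z, ω z (X u) ≠ 0

namespace LogicalFrame

variable {k G A B : Type*} [Field k] [AddCommGroup G] [Module k G] {ψ : AddChar k ℂ}
  {ω : LinearMap.BilinForm k G} [AddCommGroup A] [Module k A] [AddCommGroup B] [Module k B]
  (L : LogicalFrame ω A B) {q n m c : ℕ} (W : WeylSystem ψ ω (Fin n → Fin q))
  (φ : (Fin n → Fin q) → ℂ) (eA : (Fin m → Fin q) ≃ A) (eB : (Fin c → Fin q) ≃ B)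

/-- The encoder that shifts the stabilizer state `φ` by the labels of the basis states. -/
def encoder : Matrix (Fin n → Fin q) ((Fin m → Fin q) × (Fin c → Fin q)) ℂ :=
  fun i s => (W.op (L.X (eA s.1, eB s.2)) *ᵥ φ) i

theorem encoder_conj_op_apply (hω : ω.IsAlt) (w : G) (s s' : (Fin m → Fin q) × (Fin c → Fin q)) :
    ((L.encoder W φ eA eB)ᴴ * W.op w * L.encoder W φ eA eB) s s' =
      ψ (2⁻¹ * ω w (L.X (eA s.1 + eA s'.1, eB s.2 + eB s'.2))) *
        W.expect φ (w + L.X (eA s'.1 - eA s.1, eB s'.2 - eB s.2)) := by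
  rw [← Prod.mk_sub_mk, ← Prod.mk_add_mk, map_sub, map_add, map_add,
    ← W.star_op_mulVec_dotProduct hω φ (L.commute _ _), Matrix.mul_assoc]
  rfl

variable {φ}

theorem encoder_isometry [NeZero (2 : k)] (hψ : ψ ≠ 1) (hω : ω.IsAlt)
    (hφ : W.IsStabilizerState L.Z φ) : (L.encoder W φ eA eB)ᴴ * L.encoder W φ eA eB = 1 := by
  ext s s'
  have h := L.encoder_conj_op_apply W φ eA eB hω 0 s s'
  rw [W.op_zero, Matrix.mul_one, map_zero, LinearMap.zero_apply, mul_zero,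
    AddChar.map_zero_eq_one, one_mul, zero_add] at h
  rw [h]
  by_cases hs : s = s'
  · rw [hs, Matrix.one_apply_eq, sub_self, sub_self, Prod.mk_zero_zero, map_zero,
      hφ.expect_eq_one L.Z.zero_mem]
  · obtain ⟨z, hz, hzX⟩ := L.separating (eA s'.1 - eA s.1, eB s'.2 - eB s.2) (by
      simpa [sub_eq_zero, Prod.ext_iff] using Ne.symm hs)
    rw [Matrix.one_apply_ne hs, hφ.expect_eq_zero hψ hω hz hzX]

/-- The entanglement-assisted code of a logical frame and a stabilizer state. -/
def eaCode [NeZero (2 : k)] (hψ : ψ ≠ 1) (hω : ω.IsAlt) (hφ : W.IsStabilizerState L.Z φ) :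
    EACode q n m c :=
  ⟨L.encoder W φ eA eB, L.encoder_isometry W eA eB hψ hω hφ⟩

variable {W} [NeZero (2 : k)] (hψ : ψ ≠ 1) (hω : ω.IsAlt) (hφ : W.IsStabilizerState L.Z φ)

theorem compress_op_apply (w : G) (x x' : Fin m → Fin q) :
    (L.eaCode W eA eB hψ hω hφ).compress (W.op w) x x' =
      ((q : ℂ) ^ c)⁻¹ * (∑ b, ψ (ω w (L.X (0, eB b)))) *
        (ψ (2⁻¹ * ω w (L.X (eA x + eA x', 0))) * W.expect φ (w + L.X (eA x' - eA x, 0))) := by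
  rw [EACode.compress_apply, mul_assoc, Finset.sum_mul]
  refine congrArg _ (Finset.sum_congr rfl fun b _ => ?_)
  refine (L.encoder_conj_op_apply W φ eA eB hω w _ _).trans ?_
  have hsplit : L.X (eA x + eA x', eB b + eB b) =
      L.X (eA x + eA x', 0) + (2 : k) • L.X (0, eB b) := by
    rw [← map_smul, ← L.X.map_add]
    simp [two_smul]
  rw [sub_self, hsplit, map_add, map_smul, mul_add, smul_eq_mul,
    inv_mul_cancel_left₀ (two_ne_zero' k), AddChar.map_add_eq_mul]
  ring

variable {L}

theorem detects_of_apply_inr_ne_zero {w : G} {b : B} (hb : ω w (L.X (0, b)) ≠ 0) :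
    (L.eaCode W eA eB hψ hω hφ).Detects (W.op w) := by
  have := Fintype.ofEquiv _ eB
  have hf : (ω w).comp (L.X.comp (LinearMap.inr k A B)) ≠ 0 := fun h =>
    hb (LinearMap.congr_fun h b)
  refine ⟨0, Matrix.ext fun x x' => (L.compress_op_apply eA eB hψ hω hφ w x x').trans ?_⟩
  rw [Equiv.sum_comp eB fun b => ψ (ω w (L.X (0, b)))]
  have := sum_addChar_comp_eq_zero hψ hf
  simp only [LinearMap.comp_apply, LinearMap.inr_apply] at this
  rw [this, mul_zero, zero_mul, zero_smul, Matrix.zero_apply]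

theorem detects_of_mem {w z : G} (hz : z ∈ L.Z) (hzX : ∀ a, ω z (L.X (a, 0)) = 0)
    (hzw : ω z w ≠ 0) : (L.eaCode W eA eB hψ hω hφ).Detects (W.op w) := by
  refine ⟨0, Matrix.ext fun x x' => (L.compress_op_apply eA eB hψ hω hφ w x x').trans ?_⟩
  rw [hφ.expect_eq_zero hψ hω hz (by rwa [map_add, hzX, add_zero]), mul_zero, mul_zero,
    zero_smul, Matrix.zero_apply]

variable [NeZero q]

theorem compress_op_apply_of_forall_inr {w : G} (hw : ∀ b, ω w (L.X (0, b)) = 0) (a a' : A) :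
    (L.eaCode W eA eB hψ hω hφ).compress (W.op w) (eA.symm a) (eA.symm a') =
      ψ (2⁻¹ * ω w (L.X (a + a', 0))) * W.expect φ (w + L.X (a' - a, 0)) := by
  have hq : ((q : ℂ) ^ c) ≠ 0 := pow_ne_zero _ (NeZero.ne _)
  simp [compress_op_apply, hw, hq]

theorem detects_of_mem_of_forall {w : G} (hw : w ∈ L.Z) (hwX : ∀ u, ω w (L.X u) = 0) :
    (L.eaCode W eA eB hψ hω hφ).Detects (W.op w) := by
  refine ⟨1, Matrix.ext fun x x' => ?_⟩
  have h := compress_op_apply_of_forall_inr eA eB hψ hω hφ (fun b => hwX (0, b)) (eA x) (eA x')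
  rw [Equiv.symm_apply_apply, Equiv.symm_apply_apply, hwX, mul_zero, AddChar.map_zero_eq_one,
    one_mul] at h
  refine h.trans ?_
  rw [one_smul]
  by_cases hx : x = x'
  · rw [hx, sub_self, Prod.mk_zero_zero, map_zero, add_zero, hφ.expect_eq_one hw,
      Matrix.one_apply_eq]
  · obtain ⟨z, hz, hzX⟩ := L.separating (eA x' - eA x, 0) (by
      simpa [sub_eq_zero] using Ne.symm hx)
    have hzw : ω z w = 0 := L.isotropic hw z hz
    rw [Matrix.one_apply_ne hx, hφ.expect_eq_zero hψ hω hz (by rwa [map_add, hzw, zero_add])]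

theorem not_detects_of_sub_mem {w : G} (hw : ∀ b, ω w (L.X (0, b)) = 0) {a : A} (ha : a ≠ 0)
    (hwa : w - L.X (a, 0) ∈ L.Z) : ¬ (L.eaCode W eA eB hψ hω hφ).Detects (W.op w) := by
  rintro ⟨t, ht⟩
  have h := compress_op_apply_of_forall_inr eA eB hψ hω hφ hw a 0
  have hneg : L.X (0 - a, 0) = -L.X (a, 0) := by rw [← map_neg]; simp
  rw [hneg, ← sub_eq_add_neg, hφ.expect_eq_one hwa, mul_one] at h
  refine addChar_ne_zero _ (h.symm.trans ((congrFun₂ ht _ _).trans ?_))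
  rw [Matrix.smul_apply, Matrix.one_apply_ne (by simpa using ha), smul_zero]

theorem not_detects_of_apply_inl_ne_zero {w : G} (hw : ∀ b, ω w (L.X (0, b)) = 0) {a : A}
    (ha : ω w (L.X (a, 0)) ≠ 0) (hwZ : w ∈ L.Z) :
    ¬ (L.eaCode W eA eB hψ hω hφ).Detects (W.op w) := by
  obtain ⟨t, ht⟩ := exists_addChar_mul_ne_one hψ ha
  rintro ⟨z, hz⟩
  have diag (a) : ψ (2⁻¹ * ω w (L.X (a + a, 0))) = z := by
    have h := compress_op_apply_of_forall_inr eA eB hψ hω hφ hw a a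
    rw [sub_self, Prod.mk_zero_zero, map_zero, add_zero, hφ.expect_eq_one hwZ, mul_one] at h
    refine h.symm.trans ((congrFun₂ hz _ _).trans ?_)
    rw [Matrix.smul_apply, Matrix.one_apply_eq, smul_eq_mul, mul_one]
  refine ht (Eq.trans ?_ ((diag (t • a)).trans (diag 0).symm) |>.trans ?_)
  · have hdouble : L.X (t • a + t • a, 0) = (2 * t) • L.X (a, 0) := by
      rw [← map_smul]
      simp [two_mul, add_smul]
    rw [hdouble, map_smul, smul_eq_mul, mul_assoc, inv_mul_cancel_left₀ (two_ne_zero' k)]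
  · rw [add_zero, Prod.mk_zero_zero, map_zero, map_zero, mul_zero, AddChar.map_zero_eq_one]

end LogicalFrame

section SymplecticFrame

variable {k G : Type*} [Field k] [AddCommGroup G] [Module k G] {ω : LinearMap.BilinForm k G}

theorem sup_le_orthogonal_sup (hω : ω.IsRefl) {U V : Submodule k G} (hU : U ≤ ω.orthogonal U)
    (hV : V ≤ ω.orthogonal V) (hUV : U ≤ ω.orthogonal V) : U ⊔ V ≤ ω.orthogonal (U ⊔ V) := by
  have mem {w : G} (h : ∀ u ∈ U, ω u w = 0) (h' : ∀ v ∈ V, ω v w = 0) :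
      w ∈ ω.orthogonal (U ⊔ V) := fun x hx => by
    obtain ⟨u, hu, v, hv, rfl⟩ := Submodule.mem_sup.1 hx
    rw [LinearMap.BilinForm.add_left, h u hu, h' v hv, add_zero]
  exact sup_le (fun w hw => mem (hU hw) (hUV hw))
    fun w hw => mem (fun u hu => hω _ _ (hUV hu w hw)) (hV hw)

theorem IsHyperbolic.span_range_le_orthogonal_span {ι : Type*} [DecidableEq ι] {x z : ι → G}
    (h : IsHyperbolic ω x z) : Submodule.span k (Set.range z) ≤
      ω.orthogonal (Submodule.span k (Set.range z)) := by
  refine Submodule.span_le.2 (Set.range_subset_iff.2 fun j v hv => ?_)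
  have hle : Submodule.span k (Set.range z) ≤ LinearMap.ker (ω.flip (z j)) :=
    Submodule.span_le.2 (Set.range_subset_iff.2 fun i => h.zz i j)
  exact hle hv

variable {ι κ : Type*} [Fintype ι] [DecidableEq ι] [Fintype κ] [DecidableEq κ] {xC zC : ι → G}
  {xD zD : κ → G} {C : Submodule k G}

theorem inf_orthogonal_sup_span_le_orthogonal (hω : ω.IsAlt) (hC : IsHyperbolicBasis ω C xC zC)
    (hD : IsHyperbolicBasis ω (ω.orthogonal C) xD zD) :
    C ⊓ ω.orthogonal C ⊔ (Submodule.span k (Set.range zC) ⊔ Submodule.span k (Set.range zD)) ≤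
      ω.orthogonal (C ⊓ ω.orthogonal C ⊔
        (Submodule.span k (Set.range zC) ⊔ Submodule.span k (Set.range zD))) := by
  have hCC := LinearMap.BilinForm.le_orthogonal_orthogonal hω.isRefl (N := C)
  have hzC : Submodule.span k (Set.range zC) ≤ C :=
    Submodule.span_le.2 (Set.range_subset_iff.2 hC.z_mem)
  have hzD : Submodule.span k (Set.range zD) ≤ ω.orthogonal C :=
    Submodule.span_le.2 (Set.range_subset_iff.2 hD.z_mem)
  refine sup_le_orthogonal_sup hω.isRefl
    (inf_le_right.trans (LinearMap.BilinForm.orthogonal_le inf_le_left))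
    (sup_le_orthogonal_sup hω.isRefl hC.span_range_le_orthogonal_span
      hD.span_range_le_orthogonal_span
      (hzC.trans (hCC.trans (LinearMap.BilinForm.orthogonal_le hzD)))) ?_
  rintro v ⟨hvC, hvD⟩ x hx
  obtain ⟨u, hu, w, hw, rfl⟩ := Submodule.mem_sup.1 hx
  rw [LinearMap.BilinForm.add_left, hvD u (hzC hu),
    hCC hvC w (hzD hw), add_zero]

/-- The logical frame of a subspace `C` and hyperbolic bases of `C` and of its orthogonal space:
`C` modulo `C ⊓ Cᗮ` contains the operators on the messages, and `Cᗮ` modulo `C ⊓ Cᗮ` those on the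
entangled pairs. -/
noncomputable def symplecticFrame (hω : ω.IsAlt) (hC : IsHyperbolicBasis ω C xC zC)
    (hD : IsHyperbolicBasis ω (ω.orthogonal C) xD zD) : LogicalFrame ω (ι → k) (κ → k) where
  Z := C ⊓ ω.orthogonal C ⊔ (Submodule.span k (Set.range zC) ⊔ Submodule.span k (Set.range zD))
  X := (Fintype.linearCombination k xC).coprod (Fintype.linearCombination k xD)
  isotropic := inf_orthogonal_sup_span_le_orthogonal hω hC hD
  commute u v := by
    have hCD (i j) : ω (xC i) (xD j) = 0 := hD.x_mem j _ (hC.x_mem i)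
    have hDC (i j) : ω (xD i) (xC j) = 0 := hω.isRefl _ _ (hCD j i)
    simp [Fintype.linearCombination_apply, hC.xx, hD.xx, hCD, hDC]
  separating u hu := by
    have hzC (i) : ω (zC i) (Fintype.linearCombination k xC u.1) = -u.1 i := by
      simp [Fintype.linearCombination_apply, hC.zx hω]
    have hzD (i) : ω (zD i) (Fintype.linearCombination k xD u.2) = -u.2 i := by
      simp [Fintype.linearCombination_apply, hD.zx hω]
    have hCD (i) : ω (zC i) (Fintype.linearCombination k xD u.2) = 0 := by
      simp [Fintype.linearCombination_apply, hD.x_mem _ _ (hC.z_mem i)]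
    have hDC (i) : ω (zD i) (Fintype.linearCombination k xC u.1) = 0 := by
      simp [Fintype.linearCombination_apply, hω.isRefl _ _ (hD.z_mem i _ (hC.x_mem _))]
    by_contra! h
    refine hu (Prod.ext (funext fun i => ?_) (funext fun i => ?_))
    · simpa [hzC, hCD] using h (zC i) (Submodule.mem_sup_right (Submodule.mem_sup_left
        (Submodule.subset_span ⟨i, rfl⟩)))
    · simpa [hzD, hDC] using h (zD i) (Submodule.mem_sup_right (Submodule.mem_sup_right
        (Submodule.subset_span ⟨i, rfl⟩)))

namespace symplecticFrame

variable (hω : ω.IsAlt) (hC : IsHyperbolicBasis ω C xC zC)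
  (hD : IsHyperbolicBasis ω (ω.orthogonal C) xD zD)

theorem X_inl (a : ι → k) : (symplecticFrame hω hC hD).X (a, 0) = ∑ i, a i • xC i := by
  simp [symplecticFrame, Fintype.linearCombination_apply]

theorem X_inr (b : κ → k) : (symplecticFrame hω hC hD).X (0, b) = ∑ i, b i • xD i := by
  simp [symplecticFrame, Fintype.linearCombination_apply]

theorem X_single_inl (i : ι) : (symplecticFrame hω hC hD).X (Pi.single i 1, 0) = xC i := by
  simp [X_inl, Pi.single_apply, ite_smul]

theorem X_single_inr (i : κ) : (symplecticFrame hω hC hD).X (0, Pi.single i 1) = xD i := by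
  simp [X_inr, Pi.single_apply, ite_smul]

theorem X_inl_mem (a : ι → k) : (symplecticFrame hω hC hD).X (a, 0) ∈ C := by
  rw [X_inl]
  exact C.sum_mem fun i _ => C.smul_mem _ (hC.x_mem i)

theorem X_inr_mem (b : κ → k) : (symplecticFrame hω hC hD).X (0, b) ∈ ω.orthogonal C := by
  rw [X_inr]
  exact (ω.orthogonal C).sum_mem fun i _ => (ω.orthogonal C).smul_mem _ (hD.x_mem i)

theorem inf_orthogonal_le_Z : C ⊓ ω.orthogonal C ≤ (symplecticFrame hω hC hD).Z := le_sup_left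

theorem zC_mem (i : ι) : zC i ∈ (symplecticFrame hω hC hD).Z :=
  Submodule.mem_sup_right (Submodule.mem_sup_left (Submodule.subset_span ⟨i, rfl⟩))

theorem zD_mem (i : κ) : zD i ∈ (symplecticFrame hω hC hD).Z :=
  Submodule.mem_sup_right (Submodule.mem_sup_right (Submodule.subset_span ⟨i, rfl⟩))

theorem apply_X_eq_zero {w : G} (hwC : w ∈ C) (hwD : w ∈ ω.orthogonal C)
    (u : (ι → k) × (κ → k)) : ω w ((symplecticFrame hω hC hD).X u) = 0 := by
  have hsplit : u = (u.1, 0) + (0, u.2) := by simp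
  rw [hsplit, map_add, map_add, X_inr_mem hω hC hD _ w hwC,
    hω.isRefl _ _ (hwD _ (X_inl_mem hω hC hD _)), add_zero]

theorem exists_separating_of_notMem [FiniteDimensional k G] (hnd : ω.Nondegenerate) {w : G}
    (hw : w ∉ C) : (∃ b, ω w ((symplecticFrame hω hC hD).X (0, b)) ≠ 0) ∨
      ∃ z ∈ (symplecticFrame hω hC hD).Z,
        (∀ a, ω z ((symplecticFrame hω hC hD).X (a, 0)) = 0) ∧ ω z w ≠ 0 := by
  by_contra! h
  obtain ⟨hX, hZ⟩ := h
  have hDC {v} (hv : v ∈ ω.orthogonal C) (a) : ω v ((symplecticFrame hω hC hD).X (a, 0)) = 0 :=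
    hω.isRefl _ _ (hv _ (X_inl_mem hω hC hD a))
  have hx (i) : ω w (xD i) = 0 := X_single_inr hω hC hD i ▸ hX (Pi.single i 1)
  have hz (i) : ω w (zD i) = 0 :=
    hω.isRefl _ _ (hZ _ (zD_mem hω hC hD i) (hDC (hD.z_mem i)))
  rw [← LinearMap.BilinForm.orthogonal_orthogonal hnd hω.isRefl C] at hw
  refine hw fun v hv => hω.isRefl _ _ ?_
  obtain ⟨hrD, hrC⟩ := hD.sub_mem v hv
  rw [LinearMap.BilinForm.orthogonal_orthogonal hnd hω.isRefl] at hrC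
  have hr := hω.isRefl _ _ (hZ _ (inf_orthogonal_le_Z hω hC hD ⟨hrC, hrD⟩) (hDC hrD))
  rw [map_sub, apply_hyperbolicSum] at hr
  simpa [hx, hz] using hr

theorem sub_X_inl_mem {w : G} (hw : w ∈ C) :
    w - (symplecticFrame hω hC hD).X (fun i => ω w (zC i), 0) ∈ (symplecticFrame hω hC hD).Z := by
  have h := (symplecticFrame hω hC hD).Z.sub_mem
    (inf_orthogonal_le_Z hω hC hD (hC.sub_mem w hw)) (Submodule.sum_mem _ fun i _ =>
      Submodule.smul_mem _ (ω w (xC i)) (zC_mem hω hC hD i) : ∑ i, ω w (xC i) • zC i ∈ _)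
  rw [hyperbolicSum, pairingCoords_apply, Finset.sum_sub_distrib, ← X_inl hω hC hD] at h
  convert h using 1
  abel

theorem exists_of_notMem_orthogonal {w : G} (hw : w ∈ C) (hwD : w ∉ ω.orthogonal C) :
    (∃ a ≠ 0, w - (symplecticFrame hω hC hD).X (a, 0) ∈ (symplecticFrame hω hC hD).Z) ∨
      w ∈ (symplecticFrame hω hC hD).Z ∧
        ∃ a, ω w ((symplecticFrame hω hC hD).X (a, 0)) ≠ 0 := by
  by_cases hz : (fun i => ω w (zC i)) = 0
  · have hmem := sub_X_inl_mem hω hC hD hw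
    rw [hz, Prod.mk_zero_zero, map_zero, sub_zero] at hmem
    refine Or.inr ⟨hmem, by_contra fun h => hwD ?_⟩
    push Not at h
    have hx (i) : ω w (xC i) = 0 := X_single_inl hω hC hD i ▸ h (Pi.single i 1)
    have hcoords : pairingCoords ω xC zC w = 0 := Prod.ext hz (funext hx)
    simpa [hcoords, hyperbolicSum] using (hC.sub_mem w hw).2
  · exact Or.inl ⟨_, hz, sub_X_inl_mem hω hC hD hw⟩

end symplecticFrame

end SymplecticFrame

section SymplecticCode

variable {k : Type*} [Field k] [NeZero (2 : k)] {ψ : AddChar k ℂ} {q n m c : ℕ}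

theorem WeylSystem.exists_eaCode_detects_iff {G : Type*} [AddCommGroup G] [Module k G] [Finite G]
    [NeZero q] {ω : LinearMap.BilinForm k G} (W : WeylSystem ψ ω (Fin n → Fin q)) (hψ : ψ ≠ 1)
    (hω : ω.IsAlt) (hnd : ω.Nondegenerate) (hq : Nat.card k = q) {C : Submodule k G}
    (hm : Module.finrank k C = Module.finrank k ↥(C ⊓ ω.orthogonal C) + 2 * m)
    (hc : Module.finrank k (ω.orthogonal C) =
      Module.finrank k ↥(C ⊓ ω.orthogonal C) + 2 * c) :
    ∃ Q : EACode q n m c, ∀ w, Q.Detects (W.op w) ↔ (w ∈ C → w ∈ ω.orthogonal C) := by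
  have : Finite k := (Nat.card_ne_zero.1 (hq ▸ NeZero.ne q)).2
  have : FiniteDimensional k G := Module.Finite.of_finite
  obtain ⟨xC, zC, hC⟩ := exists_isHyperbolicBasis hω C hm
  obtain ⟨xD, zD, hD⟩ := exists_isHyperbolicBasis hω (ω.orthogonal C) (m := c) (by
    rw [hc, LinearMap.BilinForm.orthogonal_orthogonal hnd hω.isRefl, inf_comm])
  obtain ⟨φ, hφ⟩ := W.exists_isStabilizerState (symplecticFrame hω hC hD).isotropic
  have e : Fin q ≃ k := (Finite.equivFinOfCardEq hq).symm
  refine ⟨(symplecticFrame hω hC hD).eaCode W (.arrowCongr (.refl _) e) (.arrowCongr (.refl _) e)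
    hψ hω hφ, fun w => ⟨fun hdet hwC => by_contra fun hwD => absurd hdet ?_, fun hw => ?_⟩⟩
  · have hwX (b) := symplecticFrame.X_inr_mem hω hC hD b w hwC
    rcases symplecticFrame.exists_of_notMem_orthogonal hω hC hD hwC hwD with
      ⟨a, ha, hwa⟩ | ⟨hwZ, a, ha⟩
    · exact LogicalFrame.not_detects_of_sub_mem _ _ hψ hω hφ hwX ha hwa
    · exact LogicalFrame.not_detects_of_apply_inl_ne_zero _ _ hψ hω hφ hwX ha hwZ
  · by_cases hwC : w ∈ C
    · exact LogicalFrame.detects_of_mem_of_forall _ _ hψ hω hφ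
        (symplecticFrame.inf_orthogonal_le_Z hω hC hD ⟨hwC, hw hwC⟩)
        (symplecticFrame.apply_X_eq_zero hω hC hD hwC (hw hwC))
    · rcases symplecticFrame.exists_separating_of_notMem hω hC hD hnd hwC with
        ⟨b, hb⟩ | ⟨z, hz, hzX, hzw⟩
      · exact LogicalFrame.detects_of_apply_inr_ne_zero _ _ hψ hω hφ hb
      · exact LogicalFrame.detects_of_mem _ _ hψ hω hφ hz hzX hzw

variable {F : Type*} [AddCommGroup F] [Module k F] {τ : LinearMap.BilinForm k F}

theorem WeylSystem.IsLocal.hasMinDist [Fintype F] [DecidableEq F] [NeZero q]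
    {W : WeylSystem ψ (piForm (Fin n) τ) (Fin n → Fin q)} (hW : W.IsLocal) (hψ : ψ ≠ 1)
    (hτ : τ.IsAlt) (hnd : τ.Nondegenerate) (hF : Fintype.card F = q ^ 2)
    {C D : Submodule k (Fin n → F)} {Q : EACode q n m c}
    (hQ : ∀ w, Q.Detects (W.op w) ↔ (w ∈ C → w ∈ D)) {d : ℕ}
    (hd : IsLeast (hammingNorm '' {w | w ∈ C ∧ w ∉ D}) d) : Q.HasMinDist d := by
  refine ⟨fun S hS E hE => ?_, ?_⟩
  · obtain ⟨f, hf, rfl⟩ := hW.exists_eq_sum_of_actsOn hψ hτ hnd hF hE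
    refine EACode.Detects.sum fun w hfw => (hQ w).2 fun hwC => by_contra fun hwD => ?_
    have hle : hammingNorm w ≤ S.card := Finset.card_le_card fun i hi =>
      by_contra fun hiS => (Finset.mem_filter.1 hi).2 (hf w hfw i hiS)
    exact absurd (hd.2 ⟨w, ⟨hwC, hwD⟩, rfl⟩) (by omega)
  · obtain ⟨w, ⟨hwC, hwD⟩, rfl⟩ := hd.1
    exact ⟨Finset.univ.filter (w · ≠ 0), rfl, W.op w, hW _ w fun i hi => by simpa using hi,
      fun h => hwD ((hQ w).1 h hwC)⟩

theorem exists_eaCode_of_isAlt [Finite F] [DecidableEq F] (hψ : ψ ≠ 1) (hτ : τ.IsAlt)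
    (hnd : τ.Nondegenerate) (hF : Module.finrank k F = 2) (hq : Nat.card k = q) [NeZero q]
    {C : Submodule k (Fin n → F)}
    (hm : Module.finrank k C =
      Module.finrank k ↥(C ⊓ (piForm (Fin n) τ).orthogonal C) + 2 * m)
    (hc : Module.finrank k ((piForm (Fin n) τ).orthogonal C) =
      Module.finrank k ↥(C ⊓ (piForm (Fin n) τ).orthogonal C) + 2 * c) {d : ℕ}
    (hd : IsLeast (hammingNorm '' {w | w ∈ C ∧ w ∉ (piForm (Fin n) τ).orthogonal C}) d) :
    ∃ Q : EACode q n m c, Q.HasMinDist d := by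
  have := Fintype.ofFinite F
  have : Finite k := (Nat.card_ne_zero.1 (hq ▸ NeZero.ne q)).2
  obtain ⟨W, hW⟩ := WeylSystem.exists_isLocal hψ hτ hnd hF hq n
  obtain ⟨Q, hQ⟩ := W.exists_eaCode_detects_iff hψ (piForm_isAlt hτ) (piForm_nondegenerate hτ hnd)
    hq hm hc
  refine ⟨Q, hW.hasMinDist hψ hτ hnd ?_ hQ hd⟩
  rw [← Nat.card_eq_fintype_card, Module.natCard_eq_pow_finrank (K := k), hF, hq]

end SymplecticCode

/-! ### Hermitian duals -/

theorem exists_primePow_eq_of_card_eq_sq {F : Type*} [Field F] [Fintype F] {q : ℕ}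
    (hF : Fintype.card F = q ^ 2) : ∃ p e : ℕ, p.Prime ∧ CharP F p ∧ q = p ^ e := by
  obtain ⟨p, hchar, a, hp, ha⟩ := FiniteField.card' F
  obtain ⟨e, -, he⟩ := (Nat.dvd_prime_pow hp).1 (ha ▸ hF ▸ dvd_pow_self q two_ne_zero)
  exact ⟨p, e, hp, hchar, he⟩

theorem exists_ringHom_eq_pow {F : Type*} [Field F] [Fintype F] {q : ℕ}
    (hF : Fintype.card F = q ^ 2) (K : Type*) [Field K] [Algebra F K] :
    ∃ σ : K →+* K, ∀ x, σ x = x ^ q := by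
  obtain ⟨p, e, hp, _, rfl⟩ := exists_primePow_eq_of_card_eq_sq hF
  have := Fact.mk hp
  have : CharP K p := charP_of_injective_algebraMap (algebraMap F K).injective p
  exact ⟨iterateFrobenius K p e, fun x => iterateFrobenius_def p e x⟩

theorem exists_subfield_card_eq {F : Type*} [Field F] [Fintype F] {q : ℕ}
    (hF : Fintype.card F = q ^ 2) :
    ∃ k : Subfield F, Nat.card k = q ∧ Module.finrank k F = 2 := by
  obtain ⟨p, e, hp, _, rfl⟩ := exists_primePow_eq_of_card_eq_sq hF
  have := Fact.mk hp
  have he : e ≠ 0 := by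
    rintro rfl
    exact Fintype.one_lt_card.ne' hF
  let _ : Algebra (ZMod p) F := ZMod.algebra F p
  have hfin : Module.finrank (ZMod p) F = e * 2 := by
    refine Nat.pow_right_injective hp.two_le ?_
    simp only [FiniteField.pow_finrank_eq_card, hF, pow_mul]
  obtain ⟨f⟩ := FiniteField.nonempty_algHom_of_finrank_dvd (F := ZMod p) (K := GaloisField p e)
    (L := F) (by rw [GaloisField.finrank p he, hfin]; exact dvd_mul_right e 2)
  have hk : Nat.card f.toRingHom.fieldRange = p ^ e := by
    rw [← GaloisField.card p e he]
    exact Nat.card_range_of_injective f.injective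
  refine ⟨f.toRingHom.fieldRange, hk, ?_⟩
  refine Nat.pow_right_injective (Nat.one_lt_pow he hp.one_lt) ?_
  have h := Module.natCard_eq_pow_finrank (K := f.toRingHom.fieldRange) (V := F)
  rw [hk, Nat.card_eq_fintype_card, hF] at h
  exact h.symm

/-- The Hermitian dual of a linear code `C` over a field with `q ^ 2` elements, for the Hermitian
form `∑ i, v i * w i ^ q`. -/
def hermDual {F : Type*} [Field F] {ι : Type*} [Fintype ι] (q : ℕ) (C : Submodule F (ι → F)) :
    Submodule F (ι → F) where
  carrier := {v | ∀ w ∈ C, ∑ i, v i * w i ^ q = 0}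
  zero_mem' w _ := by simp
  add_mem' hu hv w hw := by
    simp only [Pi.add_apply, add_mul, Finset.sum_add_distrib, hu w hw, hv w hw, add_zero]
  smul_mem' a v hv w hw := by
    simp only [Pi.smul_apply, smul_eq_mul, mul_assoc, ← Finset.mul_sum, hv w hw, mul_zero]

theorem mem_hermDual {F : Type*} [Field F] {ι : Type*} [Fintype ι] {q : ℕ}
    {C : Submodule F (ι → F)} {v : ι → F} :
    v ∈ hermDual q C ↔ ∀ w ∈ C, ∑ i, v i * w i ^ q = 0 :=
  Iff.rfl

section TraceForm

theorem eq_zero_of_forall_trace_mul_eq_zero {k F : Type*} [Field k] [Field F] [Algebra k F]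
    [FiniteDimensional k F] [Algebra.IsSeparable k F] {a : F}
    (h : ∀ b, Algebra.trace k F (a * b) = 0) : a = 0 :=
  (traceForm_nondegenerate k F).1 a h

variable {k F : Type*} [Field k] [Fintype k] [Field F] [Algebra k F]

/-- The trace-Hermitian form `(u, v) ↦ Tr (γ u v ^ q)` of a finite extension of the field `k` with
`q` elements. In degree two it is alternating if `γ ^ q = -γ`; it turns Hermitian duality over the
extension into symplectic duality over `k`. -/
noncomputable def hermTraceForm (k : Type*) {F : Type*} [Field k] [Fintype k] [Field F]
    [Algebra k F] (γ : F) : LinearMap.BilinForm k F :=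
  (Algebra.traceForm k F).comp (LinearMap.mulLeft k γ)
    (FiniteField.frobeniusAlgHom k F).toLinearMap

theorem hermTraceForm_apply (γ u v : F) :
    hermTraceForm k γ u v = Algebra.trace k F (γ * u * v ^ Fintype.card k) :=
  rfl

theorem piForm_hermTraceForm {ι : Type*} [Fintype ι] (γ : F) (u v : ι → F) :
    piForm ι (hermTraceForm k γ) u v =
      Algebra.trace k F (γ * ∑ i, u i * v i ^ Fintype.card k) := by
  simp only [piForm_apply, hermTraceForm_apply, Finset.mul_sum, map_sum, mul_assoc]

theorem trace_pow_card [Finite F] (x : F) :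
    Algebra.trace k F (x ^ Fintype.card k) = Algebra.trace k F x :=
  Algebra.trace_eq_of_algEquiv (FiniteField.frobeniusAlgEquivOfAlgebraic k F) x

theorem pow_card_pow_card [Finite F] (hF : Module.finrank k F = 2) (x : F) :
    (x ^ Fintype.card k) ^ Fintype.card k = x := by
  have := Fintype.ofFinite F
  rw [← pow_mul, ← sq, ← hF, ← Module.card_eq_pow_finrank, FiniteField.pow_card]

theorem exists_pow_card_eq_neg [Finite F] (hF : Module.finrank k F = 2) :
    ∃ γ : F, γ ≠ 0 ∧ γ ^ Fintype.card k = -γ := by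
  have hne : FiniteField.frobeniusAlgHom k F ≠ AlgHom.id k F := fun h => by
    have := FiniteField.orderOf_frobeniusAlgHom k F
    rw [h, hF] at this
    exact absurd (orderOf_one.symm.trans this) (by decide)
  obtain ⟨x, hx⟩ := DFunLike.ne_iff.1 hne
  refine ⟨x ^ Fintype.card k - x, sub_ne_zero.2 hx, ?_⟩
  rw [← FiniteField.frobeniusAlgHom_apply k F, map_sub, FiniteField.frobeniusAlgHom_apply,
    FiniteField.frobeniusAlgHom_apply, pow_card_pow_card hF, neg_sub]

theorem hermTraceForm_isAlt [NeZero (2 : k)] [Finite F] (hF : Module.finrank k F = 2) {γ : F}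
    (hγ : γ ^ Fintype.card k = -γ) : (hermTraceForm k γ).IsAlt := fun u => by
  have hconj : (γ * u * u ^ Fintype.card k) ^ Fintype.card k = -(γ * u * u ^ Fintype.card k) := by
    rw [mul_pow, mul_pow, hγ, pow_card_pow_card hF]
    ring
  have htrace := trace_pow_card (k := k) (γ * u * u ^ Fintype.card k)
  rw [hconj, map_neg] at htrace
  rw [hermTraceForm_apply]
  exact (mul_eq_zero.1 (by linear_combination -htrace)).resolve_left (two_ne_zero (α := k))

theorem hermTraceForm_nondegenerate [NeZero (2 : k)] [Finite F] (hF : Module.finrank k F = 2)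
    {γ : F} (hγ0 : γ ≠ 0) (hγ : γ ^ Fintype.card k = -γ) : (hermTraceForm k γ).Nondegenerate := by
  refine (hermTraceForm_isAlt hF hγ).isRefl.nondegenerate_iff_separatingLeft.2 fun u hu => ?_
  refine (mul_eq_zero.1 (eq_zero_of_forall_trace_mul_eq_zero (k := k) fun b => ?_)).resolve_left hγ0
  rw [← hu (b ^ Fintype.card k), hermTraceForm_apply, pow_card_pow_card hF]

theorem orthogonal_restrictScalars {ι : Type*} [Fintype ι] [Finite F]
    (hF : Module.finrank k F = 2) {γ : F} (hγ0 : γ ≠ 0) (C : Submodule F (ι → F)) :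
    (piForm ι (hermTraceForm k γ)).orthogonal (C.restrictScalars k) =
      (hermDual (Fintype.card k) C).restrictScalars k := by
  ext v
  have hconj (w : ι → F) : (∑ i, v i * w i ^ Fintype.card k) ^ Fintype.card k =
      ∑ i, w i * v i ^ Fintype.card k := by
    rw [← FiniteField.frobeniusAlgHom_apply k F, map_sum]
    refine Finset.sum_congr rfl fun i _ => ?_
    rw [FiniteField.frobeniusAlgHom_apply, mul_pow, pow_card_pow_card hF, mul_comm]
  simp only [LinearMap.BilinForm.mem_orthogonal_iff, Submodule.restrictScalars_mem, mem_hermDual,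
    piForm_hermTraceForm, ← hconj]
  refine ⟨fun h w hw => ?_, fun h w hw => by
    rw [h w hw, zero_pow Fintype.card_ne_zero, mul_zero, map_zero]⟩
  refine eq_zero_of_pow_eq_zero (n := Fintype.card k) ((mul_eq_zero.1
    (eq_zero_of_forall_trace_mul_eq_zero (k := k) fun b => ?_)).resolve_left hγ0)
  rw [← h (b • w) (C.smul_mem b hw), hconj, hconj, mul_assoc, mul_comm _ b, Finset.mul_sum]
  simp only [Pi.smul_apply, smul_eq_mul, mul_assoc]

theorem exists_eaCode_of_hermDual_card [NeZero (2 : k)] [Finite F] [DecidableEq F]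
    (hF : Module.finrank k F = 2) {n m c d : ℕ} {C : Submodule F (Fin n → F)}
    (hm : Module.finrank F C = Module.finrank F ↥(C ⊓ hermDual (Fintype.card k) C) + m)
    (hc : Module.finrank F (hermDual (Fintype.card k) C) =
      Module.finrank F ↥(C ⊓ hermDual (Fintype.card k) C) + c)
    (hd : IsLeast (hammingNorm '' {w | w ∈ C ∧ w ∉ hermDual (Fintype.card k) C}) d) :
    ∃ Q : EACode (Fintype.card k) n m c, Q.HasMinDist d := by
  obtain ⟨ψ, hψ⟩ := AddChar.exists_apply_ne_zero.2 (one_ne_zero (α := k))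
  obtain ⟨γ, hγ0, hγ⟩ := exists_pow_card_eq_neg hF
  have horth := orthogonal_restrictScalars hF hγ0 C
  have hfin (U : Submodule F (Fin n → F)) :
      Module.finrank k (U.restrictScalars k) = 2 * Module.finrank F U := by
    rw [← hF]
    exact (Module.finrank_mul_finrank k F U).symm
  have hinf : C.restrictScalars k ⊓ (hermDual (Fintype.card k) C).restrictScalars k =
    (C ⊓ hermDual (Fintype.card k) C).restrictScalars k := rfl
  refine exists_eaCode_of_isAlt (ψ := ψ) (C := C.restrictScalars k) (AddChar.ne_one_iff.2 ⟨1, hψ⟩)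
    (hermTraceForm_isAlt hF hγ) (hermTraceForm_nondegenerate hF hγ0 hγ) hF
    Nat.card_eq_fintype_card ?_ ?_ ?_
  · rw [horth, hinf, hfin, hfin, hm, mul_add]
  · rw [horth, hinf, hfin, hfin, hc, mul_add]
  · rw [horth]
    exact hd

end TraceForm

theorem exists_eaCode_of_hermDual {F : Type*} [Field F] [Fintype F] [DecidableEq F] {q n m c d : ℕ}
    (hF : Fintype.card F = q ^ 2) (hq : Odd q) {C : Submodule F (Fin n → F)}
    (hm : Module.finrank F C = Module.finrank F ↥(C ⊓ hermDual q C) + m)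
    (hc : Module.finrank F (hermDual q C) = Module.finrank F ↥(C ⊓ hermDual q C) + c)
    (hd : IsLeast (hammingNorm '' {w | w ∈ C ∧ w ∉ hermDual q C}) d) :
    ∃ Q : EACode q n m c, Q.HasMinDist d := by
  obtain ⟨k, hk, hkF⟩ := exists_subfield_card_eq hF
  have := Fintype.ofFinite k
  obtain rfl : Fintype.card k = q := by rw [← hk, Nat.card_eq_fintype_card]
  have : NeZero (2 : k) := ⟨Ring.two_ne_zero
    (mt FiniteField.even_card_of_char_two (by rw [Nat.odd_iff.1 hq]; decide))⟩
  exact exists_eaCode_of_hermDual_card hkF hm hc hd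

theorem rank_map_ringHom {a b F K : Type*} [Finite a] [Fintype b] [Field F] [Field K]
    (φ : F →+* K) (M : Matrix a b F) : (M.map φ).rank = M.rank := by
  algebraize [φ]
  obtain ⟨κ, f, hf, hspan, hli⟩ := exists_linearIndependent' F M.row
  have := Finite.of_injective f hf
  have := Fintype.ofFinite κ
  have hliK : LinearIndependent K ((M.map φ).row ∘ f) :=
    linearIndependent_algebraMap_comp_iff.2 hli
  have hspanK : Submodule.span K (Set.range ((M.map φ).row ∘ f)) =
      Submodule.span K (Set.range (M.map φ).row) := by
    refine le_antisymm (Submodule.span_mono (Set.range_comp_subset_range _ _))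
      (Submodule.span_le.2 ?_)
    rintro _ ⟨i, rfl⟩
    have hi : M.row i ∈ Submodule.span F (Set.range (M.row ∘ f)) :=
      hspan ▸ Submodule.subset_span ⟨i, rfl⟩
    obtain ⟨c, hc⟩ := (Submodule.mem_span_range_iff_exists_fun F).1 hi
    refine (Submodule.mem_span_range_iff_exists_fun K).2 ⟨fun j => φ (c j), ?_⟩
    ext l
    simpa using congrArg φ (congrFun hc l)
  rw [Matrix.rank_eq_finrank_span_row, Matrix.rank_eq_finrank_span_row, ← hspan, ← hspanK,
    finrank_span_eq_card hli, finrank_span_eq_card hliK]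

theorem exists_vecMul_eq_of_forall_mulVec_eq_zero {b ι K : Type*} [Fintype b] [Fintype ι] [Field K]
    (V : Matrix b ι K) (u : ι → K) (h : ∀ x, V *ᵥ x = 0 → u ⬝ᵥ x = 0) : ∃ y, y ᵥ* V = u := by
  classical
  have hmem := mem_span_of_iInf_ker_le_ker (L := fun j => dotProductEquiv K ι (V.row j))
    (K := dotProductEquiv K ι u)
    fun x hx => h x (funext fun j => (Submodule.mem_iInf _).1 hx j)
  obtain ⟨y, hy⟩ := (Submodule.mem_span_range_iff_exists_fun K).1 hmem
  refine ⟨y, (dotProductEquiv K ι).injective ?_⟩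
  simp only [← hy, Matrix.vecMul_eq_sum, map_sum, map_smul]
  rfl

theorem hermTranspose_eq_transpose_map {F : Type*} [Field F] {k n q : ℕ} {σ : F →+* F}
    (hσ : ∀ x, σ x = x ^ q) (H : Matrix (Fin k) (Fin n) F) :
    hermTranspose q H = (H.map σ)ᵀ :=
  Matrix.ext fun _ _ => (hσ _).symm

section ParityCheck

variable {F : Type*} [Field F] {n k q : ℕ} {C : Submodule F (Fin n → F)}
  {H : Matrix (Fin k) (Fin n) F}

theorem exists_isParityCheck (C : Submodule F (Fin n → F)) :
    ∃ (k : ℕ) (H : Matrix (Fin k) (Fin n) F), IsParityCheck C H := by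
  let f : (Fin n → F) →ₗ[F] (Fin (Module.finrank F ((Fin n → F) ⧸ C)) → F) :=
    (Module.finBasis F ((Fin n → F) ⧸ C)).equivFun.toLinearMap ∘ₗ C.mkQ
  have hf : Function.Surjective f :=
    (Module.finBasis F ((Fin n → F) ⧸ C)).equivFun.surjective.comp C.mkQ_surjective
  have hmul (x : Fin n → F) : LinearMap.toMatrix' f *ᵥ x = f x := by
    rw [← Matrix.toLin'_apply, Matrix.toLin'_toMatrix']
  refine ⟨_, LinearMap.toMatrix' f, Matrix.vecMul_injective_iff.1 fun u v huv => ?_, fun x => ?_⟩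
  · refine dotProduct_eq _ _ fun y => ?_
    obtain ⟨x, rfl⟩ := hf y
    rw [← hmul, Matrix.dotProduct_mulVec, Matrix.dotProduct_mulVec]
    exact congrArg (· ⬝ᵥ x) huv
  · rw [hmul]
    simp [f]

namespace IsParityCheck

theorem ker_mulVecLin (hH : IsParityCheck C H) : LinearMap.ker H.mulVecLin = C := by
  ext x
  rw [LinearMap.mem_ker, Matrix.mulVecLin_apply, hH.2]

theorem finrank_add (hH : IsParityCheck C H) : k + Module.finrank F C = n := by
  have h := H.mulVecLin.finrank_range_add_finrank_ker
  rw [hH.ker_mulVecLin, ← Matrix.rank, hH.1.rank_matrix] at h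
  simpa using h

variable [Fintype F]

theorem range_hermTranspose (hF : Fintype.card F = q ^ 2) (hH : IsParityCheck C H) :
    LinearMap.range (hermTranspose q H).mulVecLin = hermDual q C := by
  obtain ⟨σ, hσ⟩ := exists_ringHom_eq_pow hF F
  have hσσ (x : F) : σ (σ x) = x := by
    rw [hσ, hσ, ← pow_mul, ← sq, ← hF, FiniteField.pow_card]
  ext v
  simp only [hermTranspose_eq_transpose_map hσ, LinearMap.mem_range, Matrix.mulVecLin_apply,
    Matrix.mulVec_transpose, mem_hermDual, ← hσ]
  constructor
  · rintro ⟨y, rfl⟩ w hw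
    change y ᵥ* H.map σ ⬝ᵥ σ ∘ w = 0
    have hσw : H.map σ *ᵥ σ ∘ w = 0 := funext fun i => by
      rw [← RingHom.map_mulVec, (hH.2 w).1 hw, Pi.zero_apply, map_zero]
    rw [← Matrix.dotProduct_mulVec, hσw, dotProduct_zero]
  · intro hv
    obtain ⟨y, hy⟩ := exists_vecMul_eq_of_forall_mulVec_eq_zero H (σ ∘ v) fun w hw => by
      have h := congrArg σ (hv w ((hH.2 w).2 hw))
      simpa [dotProduct, hσσ] using h
    refine ⟨σ ∘ y, funext fun i => ?_⟩
    rw [← RingHom.map_vecMul, hy, Function.comp_apply, hσσ]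

theorem finrank_hermDual (hF : Fintype.card F = q ^ 2) (hH : IsParityCheck C H) :
    Module.finrank F (hermDual q C) = k := by
  obtain ⟨σ, hσ⟩ := exists_ringHom_eq_pow hF F
  rw [← hH.range_hermTranspose hF, ← Matrix.rank, hermTranspose_eq_transpose_map hσ,
    Matrix.rank_transpose, rank_map_ringHom, hH.1.rank_matrix, Fintype.card_fin]

theorem finrank_hermDual_eq_add (hF : Fintype.card F = q ^ 2) (hH : IsParityCheck C H) :
    Module.finrank F (hermDual q C) =
      Module.finrank F ↥(C ⊓ hermDual q C) + (H * hermTranspose q H).rank := by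
  have h := (H.mulVecLin.domRestrict (hermDual q C)).finrank_range_add_finrank_ker
  have hrange : LinearMap.range (H.mulVecLin.domRestrict (hermDual q C)) =
      LinearMap.range (H * hermTranspose q H).mulVecLin := by
    rw [LinearMap.range_domRestrict, ← hH.range_hermTranspose hF, ← LinearMap.range_comp,
      Matrix.mulVecLin_mul]
  have hker : LinearMap.ker (H.mulVecLin.domRestrict (hermDual q C)) =
      C.comap (hermDual q C).subtype := by
    rw [LinearMap.ker_domRestrict, hH.ker_mulVecLin]
  rw [hker, hrange, ← Submodule.finrank_map_subtype_eq, Submodule.map_comap_subtype,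
    inf_comm] at h
  rw [Matrix.rank, ← h, add_comm]

end IsParityCheck

end ParityCheck

/-! ### Constacyclic codes and their zeros -/

section GeneratorPolynomial

open Polynomial

variable {F K : Type*} [Field F] [Field K] [Algebra F K] {n : ℕ}

theorem wordPoly_eq_degreeLTEquiv_symm (c : Fin n → F) :
    wordPoly c = (degreeLTEquiv F n).symm c := by
  simp [wordPoly, degreeLTEquiv, C_mul_X_pow_eq_monomial]

theorem degree_wordPoly_lt (c : Fin n → F) : (wordPoly c).degree < n := by
  rw [wordPoly_eq_degreeLTEquiv_symm, ← mem_degreeLT]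
  exact ((degreeLTEquiv F n).symm c).2

theorem coeff_wordPoly (c : Fin n → F) (i : Fin n) : (wordPoly c).coeff i = c i := by
  rw [wordPoly_eq_degreeLTEquiv_symm]
  exact congrFun ((degreeLTEquiv F n).apply_symm_apply c) i

theorem wordPoly_coeff {f : F[X]} (hf : f.degree < n) :
    wordPoly (fun i : Fin n => f.coeff i) = f := by
  rw [wordPoly_eq_degreeLTEquiv_symm]
  exact congrArg Subtype.val ((degreeLTEquiv F n).symm_apply_apply ⟨f, mem_degreeLT.2 hf⟩)

theorem aeval_wordPoly (c : Fin n → F) (x : K) :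
    aeval x (wordPoly c) = ∑ i, algebraMap F K (c i) * x ^ i.val := by
  simp [wordPoly]

/-- The word of the polynomial `X ^ j * g`; for a generator polynomial `g` of a code of length `n`
and `j + g.natDegree < n`, these words form a basis of the code. -/
noncomputable def shiftWord (n : ℕ) (g : F[X]) (j : ℕ) : Fin n → F :=
  fun i => (X ^ j * g).coeff i

variable {g : F[X]} {j : ℕ}

theorem shiftWord_map_algebraMap (n : ℕ) (g : F[X]) (j : ℕ) :
    shiftWord n (g.map (algebraMap F K)) j = algebraMap F K ∘ shiftWord n g j := by
  funext i
  rw [shiftWord, Function.comp_apply, shiftWord, ← coeff_map, Polynomial.map_mul,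
    Polynomial.map_pow, map_X]

theorem wordPoly_shiftWord (hg : g.Monic) (hj : j + g.natDegree < n) :
    wordPoly (shiftWord n g j) = X ^ j * g := by
  refine wordPoly_coeff ?_
  rw [degree_mul, degree_X_pow, degree_eq_natDegree hg.ne_zero]
  exact_mod_cast hj

theorem shiftWord_ne_zero (hg : g.Monic) (hj : j + g.natDegree < n) : shiftWord n g j ≠ 0 := by
  intro h
  have hX : X ^ j * g = wordPoly (0 : Fin n → F) := h ▸ (wordPoly_shiftWord hg hj).symm
  simp [wordPoly, hg.ne_zero] at hX

theorem hammingNorm_shiftWord_le [DecidableEq F] (n : ℕ) (g : F[X]) (j : ℕ) :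
    hammingNorm (shiftWord n g j) ≤ g.natDegree + 1 := by
  have hsub : (Finset.univ.filter fun i => shiftWord n g j i ≠ 0).map Fin.valEmbedding ⊆
      Finset.Icc j (j + g.natDegree) := by
    intro i hi
    obtain ⟨i, hne, rfl⟩ := Finset.mem_map.1 hi
    replace hne := (Finset.mem_filter.1 hne).2
    rw [shiftWord, coeff_X_pow_mul', ne_eq, ite_eq_right_iff, Classical.not_imp] at hne
    have := le_natDegree_of_ne_zero hne.2
    rw [Fin.valEmbedding_apply, Finset.mem_Icc]
    omega
  have hcard := Finset.card_le_card hsub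
  rwa [Finset.card_map, Nat.card_Icc, add_assoc, add_tsub_cancel_left] at hcard

theorem linearIndependent_shiftWord (hg : g.Monic) :
    LinearIndependent F fun j : Fin (n - g.natDegree) => shiftWord n g j := by
  have hpoly : LinearIndependent F fun j : Fin (n - g.natDegree) => X ^ j.val * g := by
    have hX := ((basisMonomials F).linearIndependent.comp _
      (Fin.val_injective (n := n - g.natDegree))).map' (LinearMap.mulRight F g)
      (LinearMap.ker_eq_bot.2 (mul_left_injective₀ hg.ne_zero))
    simpa only [Function.comp_def, coe_basisMonomials, monomial_one_right_eq_X_pow,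
      LinearMap.mulRight_apply] using hX
  refine LinearIndependent.of_comp
    ((degreeLT F n).subtype ∘ₗ (degreeLTEquiv F n).symm.toLinearMap) ?_
  convert hpoly using 2 with j
  rw [← wordPoly_shiftWord hg (n := n) (by omega), wordPoly_eq_degreeLTEquiv_symm]
  rfl

theorem mem_span_shiftWord (hg : g.Monic) {c : Fin n → F} (hc : g ∣ wordPoly c) :
    c ∈ Submodule.span F (Set.range fun j : Fin (n - g.natDegree) => shiftWord n g j) := by
  obtain ⟨f, hf⟩ := hc
  have hdeg : f.degree < (n - g.natDegree : ℕ) := by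
    rcases eq_or_ne f 0 with rfl | hf0
    · simp
    have hlt := degree_wordPoly_lt c
    rw [hf, degree_mul, degree_eq_natDegree hg.ne_zero, degree_eq_natDegree hf0] at hlt
    rw [degree_eq_natDegree hf0]
    norm_cast at hlt ⊢
    omega
  refine (Submodule.mem_span_range_iff_exists_fun F).2 ⟨fun j => f.coeff j, funext fun i => ?_⟩
  rw [← coeff_wordPoly c i, hf, mul_comm]
  conv_rhs => rw [← wordPoly_coeff hdeg]
  simp only [wordPoly, Finset.sum_mul, finsetSum_coeff, Finset.sum_apply, Pi.smul_apply,
    smul_eq_mul, shiftWord, mul_assoc, coeff_C_mul]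

namespace IsGeneratorPoly

variable {α : F} {C : Submodule F (Fin n → F)}

theorem shiftWord_mem (hg : IsGeneratorPoly α C g) (hj : j + g.natDegree < n) :
    shiftWord n g j ∈ C := by
  rw [hg.mem_iff, wordPoly_shiftWord hg.monic hj]
  exact dvd_mul_left _ _

theorem eq_span_shiftWord (hg : IsGeneratorPoly α C g) :
    C = Submodule.span F (Set.range fun j : Fin (n - g.natDegree) => shiftWord n g j) := by
  refine le_antisymm (fun c hc => mem_span_shiftWord hg.monic ((hg.mem_iff c).1 hc))
    (Submodule.span_le.2 ?_)
  rintro _ ⟨j, rfl⟩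
  exact hg.shiftWord_mem (by omega)

theorem finrank_eq (hg : IsGeneratorPoly α C g) : Module.finrank F C = n - g.natDegree := by
  rw [hg.eq_span_shiftWord, finrank_span_eq_card (linearIndependent_shiftWord hg.monic),
    Fintype.card_fin]

theorem natDegree_le (hg : IsGeneratorPoly α C g) (hn : n ≠ 0) : g.natDegree ≤ n := by
  have hdeg := natDegree_le_of_dvd hg.dvd (X_pow_sub_C_ne_zero (Nat.pos_of_ne_zero hn) α)
  rwa [natDegree_X_pow_sub_C] at hdeg

theorem aeval_wordPoly_eq_zero (hg : IsGeneratorPoly α C g) {c : Fin n → F} (hc : c ∈ C) {x : K}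
    (hx : aeval x g = 0) : aeval x (wordPoly c) = 0 :=
  aeval_eq_zero_of_dvd_aeval_eq_zero ((hg.mem_iff c).1 hc) hx

theorem hasMinWeight [DecidableEq F] (hg : IsGeneratorPoly α C g) (hlt : g.natDegree < n)
    (hd : ∀ w ∈ C, w ≠ 0 → g.natDegree + 1 ≤ hammingNorm w) :
    HasMinWeight C (g.natDegree + 1) := by
  have hmem := hg.shiftWord_mem (j := 0) (by omega)
  have hne := shiftWord_ne_zero hg.monic (j := 0) (n := n) (by omega)
  refine ⟨⟨_, hmem, hne, (hammingNorm_shiftWord_le n g 0).antisymm (hd _ hmem hne)⟩, ?_⟩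
  rintro _ ⟨c, hc, hc0, rfl⟩
  exact hd c hc hc0

theorem isLeast_hammingNorm_notMem [DecidableEq F] (hg : IsGeneratorPoly α C g)
    (hd : ∀ w ∈ C, w ≠ 0 → g.natDegree + 1 ≤ hammingNorm w) {D : Submodule F (Fin n → F)}
    (hCD : ¬ C ≤ D) : IsLeast (hammingNorm '' {c | c ∈ C ∧ c ∉ D}) (g.natDegree + 1) := by
  constructor
  · by_contra hnot
    refine hCD (hg.eq_span_shiftWord.trans_le (Submodule.span_le.2 ?_))
    rintro _ ⟨j, rfl⟩
    have hj : j.val + g.natDegree < n := by omega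
    have hmem := hg.shiftWord_mem hj
    by_contra hjD
    exact hnot ⟨_, ⟨hmem, hjD⟩, (hammingNorm_shiftWord_le n g j).antisymm
      (hd _ hmem (shiftWord_ne_zero hg.monic hj))⟩
  · rintro _ ⟨c, ⟨hc, hcD⟩, rfl⟩
    exact hd c hc fun h0 => hcD (h0 ▸ D.zero_mem)

theorem exists_eaCode [Fintype F] [DecidableEq F] {q k c b : ℕ} {H : Matrix (Fin b) (Fin n) F}
    (hF : Fintype.card F = q ^ 2) (hq : Odd q) (hg : IsGeneratorPoly α C g)
    (hH : IsParityCheck C H) (hd : ∀ w ∈ C, w ≠ 0 → g.natDegree + 1 ≤ hammingNorm w)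
    (hc : (H * hermTranspose q H).rank = c) (hk : n + c = 2 * g.natDegree + k) (hk0 : k ≠ 0) :
    ∃ Q : EACode q n k c, Q.HasMinDist (g.natDegree + 1) := by
  have hb := hH.finrank_add
  have hdual := hH.finrank_hermDual hF
  have hhull := hH.finrank_hermDual_eq_add hF
  have hC := hg.finrank_eq
  have hm : Module.finrank F C = Module.finrank F ↥(C ⊓ hermDual q C) + k := by omega
  refine exists_eaCode_of_hermDual hF hq hm (hc ▸ hhull) (hg.isLeast_hammingNorm_notMem hd ?_)
  intro hle
  rw [inf_eq_left.2 hle] at hm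
  omega

end IsGeneratorPoly

theorem lt_hammingNorm_of_forall_aeval_eq_zero [DecidableEq F] {ζ b : K} {d : ℕ}
    (hζ : IsPrimitiveRoot ζ n) (hb : b ≠ 0) {c : Fin n → F}
    (h : ∀ t < d, aeval (b * ζ ^ t) (wordPoly c) = 0) (hc : c ≠ 0) : d < hammingNorm c := by
  by_contra! hle
  let S : Finset (Fin n) := {i | c i ≠ 0}
  let e : Fin (hammingNorm c) ↪o Fin n := S.orderEmbOfFin rfl
  have hrange (i : Fin n) (hi : c i ≠ 0) : i ∈ Set.range e := by
    simpa [e, S] using hi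
  have hinj : Function.Injective fun j => ζ ^ (e j).val := fun i j hij =>
    e.injective (Fin.ext (hζ.pow_inj (Fin.is_lt _) (Fin.is_lt _) hij))
  have hzero := Matrix.eq_zero_of_forall_pow_sum_mul_pow_eq_zero
    (v := fun j => algebraMap F K (c (e j)) * b ^ (e j).val) hinj fun t => by
      rw [← h t (t.2.trans_le hle), aeval_wordPoly]
      refine Fintype.sum_of_injective e e.injective _ _ (fun i hi => ?_) fun j => ?_
      · rw [not_not.1 (mt (hrange i) hi), map_zero, zero_mul]
      · rw [mul_pow, mul_assoc, pow_right_comm]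
  obtain ⟨i, hi⟩ := Function.ne_iff.1 hc
  obtain ⟨j, rfl⟩ := hrange i hi
  have hj := congrFun hzero j
  simp only [Pi.zero_apply, mul_eq_zero, map_eq_zero] at hj
  exact hj.elim hi (pow_ne_zero _ hb)

end GeneratorPolynomial

section RankHermitian

theorem rank_of_ite_eq {a b X K : Type*} [Finite a] [Fintype b] [DecidableEq X] [Field K]
    {u : a → X} {v : b → X} {c : K} (hc : c ≠ 0) :
    (Matrix.of fun i j => if u i = v j then c else 0).rank =
      (Set.range u ∩ Set.range v).ncard := by
  classical
  have := Fintype.ofFinite a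
  let I := ↥(Set.range u ∩ Set.range v)
  have : Fintype I := ((Set.finite_range u).inter_of_left (Set.range v)).fintype
  rw [← Nat.card_coe_set_eq, Nat.card_eq_fintype_card (α := I)]
  set M : Matrix a b K := Matrix.of fun i j => if u i = v j then c else 0
  refine le_antisymm ?_ ?_
  · let A : Matrix a I K := Matrix.of fun i x => if u i = x.1 then c else 0
    let B : Matrix I b K := Matrix.of fun x j => if x.1 = v j then 1 else 0
    have hfac : M = A * B := by
      ext i j
      simp only [M, A, B, Matrix.mul_apply, Matrix.of_apply, mul_ite, mul_one, mul_zero]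
      split_ifs with hij
      · rw [Finset.sum_eq_single ⟨u i, ⟨i, rfl⟩, ⟨j, hij.symm⟩⟩]
        · simp [hij]
        · intro x _ hx
          rw [if_neg fun h : u i = x => hx (Subtype.ext h.symm), ite_self]
        · simp
      · refine (Finset.sum_eq_zero fun x _ => ?_).symm
        split_ifs with hxj hix
        · exact (hij (hix.trans hxj)).elim
        · rfl
        · rfl
    rw [hfac]
    exact (Matrix.rank_mul_le_left _ _).trans (Matrix.rank_le_card_width _)
  · choose f hf using fun x : I => x.2.1
    choose h hh using fun x : I => x.2.2
    have hdiag : M.submatrix f h = Matrix.diagonal fun _ => c := by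
      ext x y
      simp [M, Matrix.diagonal_apply, hf, hh, Subtype.coe_inj]
    have hle := M.rank_submatrix_le f h
    rw [hdiag, Matrix.rank_diagonal] at hle
    simpa [hc] using hle

theorem geom_sum_eq_ite_of_pow_eq_one {K : Type*} [Field K] [DecidableEq K] {n : ℕ} {x : K}
    (hx : x ^ n = 1) : ∑ l : Fin n, x ^ l.val = if x = 1 then (n : K) else 0 := by
  rw [Fin.sum_univ_eq_sum_range (x ^ ·)]
  split_ifs with h
  · simp [h]
  · have hmul := mul_geom_sum x n
    rw [hx, sub_self] at hmul
    exact (mul_eq_zero.1 hmul).resolve_left (sub_ne_zero.2 h)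

theorem rank_mul_transpose_map_of_forall_mulVec_eq_zero {a ι K : Type*} [Fintype a] [Fintype ι]
    [Field K] (σ : K →+* K) {V W : Matrix a ι K} (hW : LinearIndependent K W.row)
    (h : ∀ x, V *ᵥ x = 0 → W *ᵥ x = 0) :
    (W * (W.map σ)ᵀ).rank = (V * (V.map σ)ᵀ).rank := by
  classical
  choose A hA using fun i =>
    exists_vecMul_eq_of_forall_mulVec_eq_zero V (W i) fun x hx => congrFun (h x hx) i
  obtain rfl : Matrix.of A * V = W := Matrix.ext fun i j => congrFun (hA i) j
  have hdet : IsUnit (Matrix.of A).det := by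
    rw [← Matrix.isUnit_iff_isUnit_det, ← Matrix.vecMul_injective_iff_isUnit]
    refine fun u v huv => Matrix.vecMul_injective_iff.2 hW ?_
    simp only [← Matrix.vecMul_vecMul]
    exact congrArg (· ᵥ* V) huv
  have hdetσ : IsUnit ((Matrix.of A).map σ)ᵀ.det := by
    rw [Matrix.det_transpose, ← RingHom.mapMatrix_apply, ← RingHom.map_det]
    exact hdet.map σ
  rw [Matrix.map_mul, Matrix.transpose_mul, ← Matrix.mul_assoc, Matrix.mul_assoc (Matrix.of A),
    Matrix.rank_mul_eq_left_of_isUnit_det _ _ hdetσ,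
    Matrix.rank_mul_eq_right_of_isUnit_det _ _ hdet]

open Polynomial

variable {F K : Type*} [Field F] [Field K] [Algebra F K] {n : ℕ} {g : F[X]}

variable (K n g) in
/-- The matrix which evaluates the polynomials of words of length `n` at the roots of `g` in `K`;
it is a parity check matrix, over `K`, of the code with generator polynomial `g`. -/
noncomputable def rootMatrix : Matrix (g.rootSet K) (Fin n) K :=
  Matrix.of fun x l => x.1 ^ l.val

theorem map_dvd_of_forall_mem_rootSet (hsep : g.Separable)
    (hsplit : (g.map (algebraMap F K)).Splits) {f : K[X]} (h : ∀ a ∈ g.rootSet K, f.eval a = 0) :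
    g.map (algebraMap F K) ∣ f := by
  rcases eq_or_ne f 0 with rfl | hf0
  · exact dvd_zero _
  refine hsplit.dvd_of_roots_le_roots (map_ne_zero hsep.ne_zero)
    ((Multiset.le_iff_subset (nodup_roots hsep.map)).2 fun a ha => ?_)
  rw [mem_roots_map hsep.ne_zero] at ha
  rw [mem_roots hf0]
  exact h a (mem_rootSet.2 ⟨hsep.ne_zero, ha⟩)

theorem rootMatrix_mulVec (x : Fin n → K) (a : g.rootSet K) :
    (rootMatrix K n g *ᵥ x) a = (wordPoly x).eval a.1 := by
  simp [rootMatrix, Matrix.mulVec, dotProduct, ← coe_aeval_eq_eval, aeval_wordPoly, mul_comm]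

namespace IsGeneratorPoly

variable {α : F} {C : Submodule F (Fin n → F)}

theorem map_mulVec_eq_zero (hg : IsGeneratorPoly α C g) {k : ℕ} {H : Matrix (Fin k) (Fin n) F}
    (hH : IsParityCheck C H) {x : Fin n → K} (hx : g.map (algebraMap F K) ∣ wordPoly x) :
    H.map (algebraMap F K) *ᵥ x = 0 := by
  have hker : Submodule.span K (Set.range fun j : Fin (n - (g.map (algebraMap F K)).natDegree) =>
      shiftWord n (g.map (algebraMap F K)) j) ≤
        LinearMap.ker (H.map (algebraMap F K)).mulVecLin := by
    rw [Submodule.span_le]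
    rintro _ ⟨j, rfl⟩
    have hj : j.val + g.natDegree < n := by
      rw [← natDegree_map (algebraMap F K)]
      omega
    refine funext fun i => ?_
    beta_reduce
    rw [shiftWord_map_algebraMap, Matrix.mulVecLin_apply, ← RingHom.map_mulVec,
      (hH.2 _).1 (hg.shiftWord_mem hj), Pi.zero_apply, map_zero, Pi.zero_apply]
  exact hker (mem_span_shiftWord (hg.monic.map _) hx)

theorem pow_eq_of_mem_rootSet (hg : IsGeneratorPoly α C g) {x : K} (hx : x ∈ g.rootSet K) :
    x ^ n = algebraMap F K α := by
  have hzero := aeval_eq_zero_of_dvd_aeval_eq_zero hg.dvd (aeval_eq_zero_of_mem_rootSet hx)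
  simpa [sub_eq_zero] using hzero

theorem separable (hg : IsGeneratorPoly α C g) (hn : (n : F) ≠ 0) (hα : α ≠ 0) : g.Separable :=
  (separable_X_pow_sub_C α hn hα).of_dvd hg.dvd

theorem splits_map (hg : IsGeneratorPoly α C g) (hn : n ≠ 0) {β ζ : K} (hζ : IsPrimitiveRoot ζ n)
    (hβ : β ^ n = algebraMap F K α) : (g.map (algebraMap F K)).Splits := by
  have hdvd := Polynomial.map_dvd (algebraMap F K) hg.dvd
  rw [Polynomial.map_sub, Polynomial.map_pow, map_X, map_C] at hdvd
  exact (X_pow_sub_C_splits_of_isPrimitiveRoot hζ hβ).of_dvd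
    (X_pow_sub_C_ne_zero (Nat.pos_of_ne_zero hn) _) hdvd

theorem rootMatrix_mul_transpose_map [DecidableEq K] (hg : IsGeneratorPoly α C g) {q : ℕ}
    {σ : K →+* K} (hσ : ∀ x, σ x = x ^ q) (hn : n ≠ 0) (hα : α ^ (q + 1) = 1) :
    rootMatrix K n g * ((rootMatrix K n g).map σ)ᵀ =
      Matrix.of fun x y => if x.1 = (y.1 ^ q)⁻¹ then (n : K) else 0 := by
  ext x y
  have hxn := hg.pow_eq_of_mem_rootSet x.2
  have hyn := hg.pow_eq_of_mem_rootSet y.2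
  have hxy : (x.1 * y.1 ^ q) ^ n = 1 := by
    rw [mul_pow, pow_right_comm, hxn, hyn, ← pow_succ', ← map_pow, hα, map_one]
  have hy0 : y.1 ^ q ≠ 0 := by
    intro h
    simp [h, hn] at hxy
  have hterm (l : Fin n) : x.1 ^ l.val * (y.1 ^ l.val) ^ q = (x.1 * y.1 ^ q) ^ l.val := by
    rw [mul_pow, pow_right_comm]
  simp only [Matrix.mul_apply, rootMatrix, Matrix.transpose_apply, Matrix.map_apply,
    Matrix.of_apply, hσ, hterm, geom_sum_eq_ite_of_pow_eq_one hxy, mul_eq_one_iff_eq_inv₀ hy0]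

theorem eq_natDegree_of_isParityCheck (hg : IsGeneratorPoly α C g) (hn : n ≠ 0) {k : ℕ}
    {H : Matrix (Fin k) (Fin n) F} (hH : IsParityCheck C H) : k = g.natDegree := by
  have hk := hH.finrank_add
  have hC := hg.finrank_eq
  have hdeg := hg.natDegree_le hn
  omega

theorem rank_mul_hermTranspose [Fintype F] (hg : IsGeneratorPoly α C g) {q k : ℕ}
    (hF : Fintype.card F = q ^ 2) {H : Matrix (Fin k) (Fin n) F} (hH : IsParityCheck C H)
    (hn : (n : F) ≠ 0) (hα : α ^ (q + 1) = 1) (hsplit : (g.map (algebraMap F K)).Splits) :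
    (H * hermTranspose q H).rank =
      (g.rootSet K ∩ (fun x => (x ^ q)⁻¹) '' g.rootSet K).ncard := by
  classical
  obtain ⟨σ, hσ⟩ := exists_ringHom_eq_pow hF K
  have hn0 : n ≠ 0 := by
    rintro rfl
    simp at hn
  have hα0 : α ≠ 0 := by
    rintro rfl
    simp at hα
  have hsep := hg.separable hn hα0
  have hnK : (n : K) ≠ 0 := by simpa using (map_ne_zero (algebraMap F K)).2 hn
  let e : Fin k ≃ g.rootSet K := Fintype.equivOfCardEq (by
    rw [card_rootSet_eq_natDegree hsep hsplit, Fintype.card_fin,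
      hg.eq_natDegree_of_isParityCheck hn0 hH])
  have hker (x : Fin n → K) (hx : (rootMatrix K n g).submatrix e id *ᵥ x = 0) :
      H.map (algebraMap F K) *ᵥ x = 0 := by
    refine hg.map_mulVec_eq_zero hH (map_dvd_of_forall_mem_rootSet hsep hsplit fun a ha => ?_)
    rw [← rootMatrix_mulVec x ⟨a, ha⟩]
    simpa [Matrix.mulVec] using congrFun hx (e.symm ⟨a, ha⟩)
  have hli : LinearIndependent K (H.map (algebraMap F K)).row :=
    linearIndependent_algebraMap_comp_iff.2 hH.1
  have hstar : (H * hermTranspose q H).map (algebraMap F K) =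
      H.map (algebraMap F K) * ((H.map (algebraMap F K)).map σ)ᵀ := by
    ext
    simp [Matrix.mul_apply, hermTranspose, hσ]
  have hgram : (rootMatrix K n g).submatrix e id * (((rootMatrix K n g).submatrix e id).map σ)ᵀ =
      (rootMatrix K n g * ((rootMatrix K n g).map σ)ᵀ).submatrix e e := rfl
  rw [← rank_map_ringHom (algebraMap F K), hstar,
    rank_mul_transpose_map_of_forall_mulVec_eq_zero σ hli hker, hgram, Matrix.rank_submatrix,
    hg.rootMatrix_mul_transpose_map hσ hn0 hα, rank_of_ite_eq hnK,
    Subtype.range_coe, Set.image_eq_range]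

end IsGeneratorPoly

end RankHermitian

/-! ### Zeros in an interval -/

section RankNine

variable {t : ℤ}

theorem abs_le_one_of_mul_eq_add {c u v : ℤ} (ht : 0 ≤ t) (hu : |u| ≤ 5 * t + 3)
    (hv : |v| ≤ 5 * t + 3)
    (hc : (10 * t ^ 2 + 14 * t + 5) * c = (t + 1) * u + (3 * t + 2) * v) : |c| ≤ 1 := by
  have hn : 0 < 10 * t ^ 2 + 14 * t + 5 := by positivity
  have hlt : (10 * t ^ 2 + 14 * t + 5) * |c| < (10 * t ^ 2 + 14 * t + 5) * 2 :=
    calc (10 * t ^ 2 + 14 * t + 5) * |c|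
        = |(t + 1) * u + (3 * t + 2) * v| := by rw [← hc, abs_mul, abs_of_pos hn]
      _ ≤ (t + 1) * |u| + (3 * t + 2) * |v| := by
        refine (abs_add_le _ _).trans_eq ?_
        rw [abs_mul, abs_mul, abs_of_pos (by omega : 0 < t + 1),
          abs_of_pos (by omega : 0 < 3 * t + 2)]
      _ ≤ (t + 1) * (5 * t + 3) + (3 * t + 2) * (5 * t + 3) := by gcongr
      _ < (10 * t ^ 2 + 14 * t + 5) * 2 := by linarith
  exact Int.lt_add_one_iff.1 (lt_of_mul_lt_mul_left hlt hn.le)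

/-- The pairs `(x, y)` with `y ≡ (10 * t + 7) * x` modulo `10 * t ^ 2 + 14 * t + 5` form a lattice
with the orthogonal basis `(t + 1, 3 * t + 2)`, `(-(3 * t + 2), t + 1)`, since
`(t + 1) ^ 2 + (3 * t + 2) ^ 2` is the modulus. -/
theorem exists_abs_le_one_of_dvd_sub {x y : ℤ} (ht : 0 ≤ t) (hx : |x| ≤ 5 * t + 3)
    (hy : |y| ≤ 5 * t + 3) (h : 10 * t ^ 2 + 14 * t + 5 ∣ y - (10 * t + 7) * x) :
    ∃ a b : ℤ, |a| ≤ 1 ∧ |b| ≤ 1 ∧ x = a * (t + 1) - b * (3 * t + 2) ∧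
      y = a * (3 * t + 2) + b * (t + 1) := by
  obtain ⟨z, hz⟩ := h
  refine ⟨3 * x + (3 * t + 2) * z, x + (t + 1) * z, ?_, ?_, by ring, by linear_combination hz⟩
  · exact abs_le_one_of_mul_eq_add ht hx hy (by linear_combination (-(3 * t + 2)) * hz)
  · exact abs_le_one_of_mul_eq_add ht hy ((abs_neg x).trans_le hx)
      (by linear_combination (-(t + 1)) * hz)

theorem setOf_dvd_add_mul_eq_image {m : ℤ} (ht : 0 ≤ t) (hm : 4 * t + 3 ≤ m)
    (hm' : m ≤ 5 * t + 3) :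
    {i ∈ Set.Icc (-m) m |
        ∃ j ∈ Set.Icc (-m) m, 10 * t ^ 2 + 14 * t + 5 ∣ i + (10 * t + 7) * j} =
      (fun v : ℤ × ℤ => v.1 * (3 * t + 2) + v.2 * (t + 1)) ''
        (Set.Icc (-1) 1 ×ˢ Set.Icc (-1) 1) := by
  ext i
  constructor
  · rintro ⟨hi, j, hj, hdvd⟩
    obtain ⟨a, b, ha, hb, -, rfl⟩ := exists_abs_le_one_of_dvd_sub (x := -j) ht
      ((abs_le.2 ⟨by linarith [hj.2], by linarith [hj.1]⟩).trans hm')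
      ((abs_le.2 hi).trans hm') (by rwa [mul_neg, sub_neg_eq_add])
    exact ⟨(a, b), ⟨abs_le.1 ha, abs_le.1 hb⟩, rfl⟩
  · rintro ⟨⟨a, b⟩, ⟨⟨ha, ha'⟩, hb, hb'⟩, rfl⟩
    refine ⟨⟨?_, ?_⟩, b * (3 * t + 2) - a * (t + 1), ⟨?_, ?_⟩, 3 * b - a, by ring⟩ <;>
      nlinarith

theorem injOn_mul_add_mul (ht : 1 ≤ t) :
    Set.InjOn (fun v : ℤ × ℤ => v.1 * (3 * t + 2) + v.2 * (t + 1))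
      (Set.Icc (-1) 1 ×ˢ Set.Icc (-1) 1) := by
  rintro ⟨a, b⟩ ⟨⟨-, ha⟩, hb, hb'⟩ ⟨c, d⟩ ⟨⟨hc, -⟩, hd, hd'⟩ h
  have hdiff : (a - c) * (3 * t + 2) = (d - b) * (t + 1) := by linear_combination h
  have hac : a - c = 0 := by
    by_contra hne
    rcases lt_or_gt_of_ne hne with hlt | hlt <;> nlinarith
  have hbd : d - b = 0 := by
    rw [hac, zero_mul] at hdiff
    exact (mul_eq_zero.1 hdiff.symm).resolve_right (by omega)
  ext <;> dsimp only at * <;> omega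

theorem ncard_setOf_dvd_add_mul {m : ℤ} (ht : 1 ≤ t) (hm : 4 * t + 3 ≤ m)
    (hm' : m ≤ 5 * t + 3) :
    {i ∈ Set.Icc (-m) m |
      ∃ j ∈ Set.Icc (-m) m, 10 * t ^ 2 + 14 * t + 5 ∣ i + (10 * t + 7) * j}.ncard = 9 := by
  rw [setOf_dvd_add_mul_eq_image (by omega) hm hm', (injOn_mul_add_mul ht).ncard_image,
    Set.ncard_prod, Set.ncard_eq_toFinset_card']
  rfl

end RankNine

section RootInterval

open Polynomial

variable {F K : Type*} [Field F] [Field K] [Algebra F K] {n : ℕ} {β ζ : K}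

theorem mul_zpow_injOn_Icc (hζ : IsPrimitiveRoot ζ n) (hβ : β ≠ 0) {m : ℕ} (hm : 2 * m < n) :
    Set.InjOn (fun j : ℤ => β * ζ ^ j) (Set.Icc (-m) m) := by
  rintro i ⟨hi, hi'⟩ j ⟨hj, hj'⟩ hij
  have hζ0 : ζ ≠ 0 := hζ.ne_zero (by omega)
  have hdvd : (n : ℤ) ∣ i - j := by
    rw [← hζ.zpow_eq_one_iff_dvd, zpow_sub₀ hζ0, mul_left_cancel₀ hβ hij,
      div_self (zpow_ne_zero j hζ0)]
  exact sub_eq_zero.1 (Int.eq_zero_of_abs_lt_dvd hdvd (abs_lt.2 ⟨by omega, by omega⟩))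

theorem image_mul_zpow_inter_image_inv_pow (hζ : IsPrimitiveRoot ζ n) (hn : n ≠ 0) {q : ℕ}
    (hβ : β ^ (q + 1) = 1) (I : Set ℤ) :
    (fun j : ℤ => β * ζ ^ j) '' I ∩ (fun x => (x ^ q)⁻¹) '' ((fun j : ℤ => β * ζ ^ j) '' I) =
      (fun j : ℤ => β * ζ ^ j) '' {i ∈ I | ∃ j ∈ I, (n : ℤ) ∣ i + q * j} := by
  have hζ0 := hζ.ne_zero hn
  have hiff (i j : ℤ) : ((β * ζ ^ j) ^ q)⁻¹ = β * ζ ^ i ↔ (n : ℤ) ∣ i + q * j := by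
    have hmul : β * ζ ^ i * (β * ζ ^ j) ^ q = ζ ^ (i + q * j) := by
      rw [mul_pow, zpow_add₀ hζ0, mul_comm (q : ℤ), zpow_mul, zpow_natCast]
      linear_combination (ζ ^ i * (ζ ^ j) ^ q) * hβ
    have hβ0 : β ≠ 0 := by
      rintro rfl
      simp at hβ
    have hne : (β * ζ ^ j) ^ q ≠ 0 := pow_ne_zero q (mul_ne_zero hβ0 (zpow_ne_zero j hζ0))
    rw [← hζ.zpow_eq_one_iff_dvd, ← hmul, mul_eq_one_iff_eq_inv₀ hne, eq_comm]
  ext x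
  constructor
  · rintro ⟨⟨i, hi, rfl⟩, _, ⟨j, hj, rfl⟩, hij⟩
    exact ⟨i, ⟨hi, j, hj, (hiff i j).1 hij⟩, rfl⟩
  · rintro ⟨i, ⟨hi, j, hj, hdvd⟩, rfl⟩
    exact ⟨⟨i, hi, rfl⟩, _, ⟨j, hj, rfl⟩, (hiff i j).2 hdvd⟩

/-- The polynomial `g` splits over `K`, where its roots are the `β * ζ ^ j` with `-m ≤ j ≤ m`, for
a primitive `n`-th root of unity `ζ`. A constacyclic code of length `n` with such a generator
polynomial attains the BCH bound. -/
structure HasRootInterval (n m : ℕ) (g : F[X]) (β ζ : K) : Prop where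
  isPrimitiveRoot : IsPrimitiveRoot ζ n
  ne_zero : β ≠ 0
  splits : (g.map (algebraMap F K)).Splits
  rootSet_eq : g.rootSet K = (fun j : ℤ => β * ζ ^ j) '' Set.Icc (-m) m

namespace HasRootInterval

variable {g : F[X]} {m : ℕ} {α : F} {C : Submodule F (Fin n → F)}

theorem natDegree_eq (h : HasRootInterval n m g β ζ) (hsep : g.Separable) (hm : 2 * m < n) :
    g.natDegree = 2 * m + 1 := by
  rw [← card_rootSet_eq_natDegree hsep h.splits, ← Nat.card_eq_fintype_card, Nat.card_coe_set_eq,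
    h.rootSet_eq, (mul_zpow_injOn_Icc h.isPrimitiveRoot h.ne_zero hm).ncard_image,
    Set.ncard_eq_toFinset_card', Set.toFinset_Icc, Int.card_Icc]
  omega

theorem le_hammingNorm [DecidableEq F] (h : HasRootInterval n m g β ζ)
    (hg : IsGeneratorPoly α C g) (hn : n ≠ 0) {w : Fin n → F} (hw : w ∈ C) (hw0 : w ≠ 0) :
    2 * m + 2 ≤ hammingNorm w := by
  have hζ0 := h.isPrimitiveRoot.ne_zero hn
  refine lt_hammingNorm_of_forall_aeval_eq_zero (b := β * ζ ^ (-m : ℤ)) h.isPrimitiveRoot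
    (mul_ne_zero h.ne_zero (zpow_ne_zero _ hζ0)) (fun t ht => ?_) hw0
  have hmem : β * ζ ^ (t - m : ℤ) ∈ g.rootSet K :=
    h.rootSet_eq ▸ Set.mem_image_of_mem _ ⟨by omega, by omega⟩
  rw [mul_assoc, ← zpow_natCast ζ t, ← zpow_add₀ hζ0, neg_add_eq_sub]
  exact hg.aeval_wordPoly_eq_zero hw (aeval_eq_zero_of_mem_rootSet hmem)

theorem hasMinWeight [DecidableEq F] (h : HasRootInterval n m g β ζ) (hg : IsGeneratorPoly α C g)
    (hsep : g.Separable) (hm : 2 * m + 1 < n) : HasMinWeight C (2 * m + 2) := by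
  have hdeg := h.natDegree_eq hsep (by omega)
  have hmin := hg.hasMinWeight (by omega) fun w hw hw0 =>
    hdeg ▸ h.le_hammingNorm hg (by omega) hw hw0
  rwa [hdeg] at hmin

theorem exists_eaCode [Fintype F] (h : HasRootInterval n m g β ζ)
    (hg : IsGeneratorPoly α C g) (hsep : g.Separable) {q k b c : ℕ}
    (hF : Fintype.card F = q ^ 2) (hq : Odd q) {H : Matrix (Fin b) (Fin n) F}
    (hH : IsParityCheck C H) (hc : (H * hermTranspose q H).rank = c) (hm : 2 * m < n)
    (hk : n + c = 2 * (2 * m + 1) + k) (hk0 : k ≠ 0) :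
    ∃ Q : EACode q n k c, Q.HasMinDist (2 * m + 2) := by
  classical
  have hdeg := h.natDegree_eq hsep hm
  have hQ := hg.exists_eaCode hF hq hH
    (fun w hw hw0 => hdeg ▸ h.le_hammingNorm hg (by omega) hw hw0) hc (hdeg ▸ hk) hk0
  rwa [hdeg] at hQ

theorem rank_mul_hermTranspose_eq_nine [Fintype F] (h : HasRootInterval n m g β ζ)
    (hg : IsGeneratorPoly α C g) {q k t : ℕ} (hF : Fintype.card F = q ^ 2)
    {H : Matrix (Fin k) (Fin n) F} (hH : IsParityCheck C H) (hn : (n : F) ≠ 0)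
    (hα : α ^ (q + 1) = 1) (hβ : β ^ (q + 1) = 1) (hqt : q = 10 * t + 7)
    (hnt : n = 10 * t ^ 2 + 14 * t + 5) (ht : 1 ≤ t) (hm : 4 * t + 3 ≤ m)
    (hm' : m ≤ 5 * t + 3) : (H * hermTranspose q H).rank = 9 := by
  have hinj := mul_zpow_injOn_Icc h.isPrimitiveRoot h.ne_zero (m := m) (by nlinarith)
  rw [hg.rank_mul_hermTranspose hF hH hn hα h.splits, h.rootSet_eq,
    image_mul_zpow_inter_image_inv_pow h.isPrimitiveRoot (by omega) hβ,
    (hinj.mono (Set.sep_subset _ _)).ncard_image,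
    ← ncard_setOf_dvd_add_mul (t := t) (m := m) (by omega) (by omega) (by omega), hnt, hqt]
  push_cast
  rfl

end HasRootInterval

end RootInterval

section DefiningSet

open Polynomial

theorem pow_val_intCast_of_isPrimitiveRoot {K : Type*} [Field K] {δ : K} {N : ℕ} [NeZero N]
    (hδ : IsPrimitiveRoot δ N) (a : ℤ) : δ ^ (a : ZMod N).val = δ ^ a := by
  have hδ0 := hδ.ne_zero (NeZero.ne N)
  rw [← zpow_natCast, ZMod.val_intCast]
  conv_rhs => rw [← Int.emod_add_mul_ediv a N]
  rw [zpow_add₀ hδ0, zpow_mul, zpow_natCast δ N, hδ.pow_eq_one, one_zpow, mul_one]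

theorem mul_pow_two_mul_eq_or {R : Type*} [CommRing R] {s r q : R} (hs : s * q ^ 2 = s)
    (hr : r * q ^ 2 = -r) (j : R) (e : ℕ) :
    (s - r * j) * q ^ (2 * e) = s - r * j ∨ (s - r * j) * q ^ (2 * e) = s + r * j := by
  induction e with
  | zero => simp
  | succ e ih =>
    rw [mul_add_one, pow_add, ← mul_assoc]
    rcases ih with h | h <;> rw [h]
    · right; linear_combination hs - j * hr
    · left; linear_combination hs + j * hr

theorem cyclotomicCoset_sub_mul {q N : ℕ} {s r : ZMod N} (hs : s * q ^ 2 = s)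
    (hr : r * q ^ 2 = -r) (j : ZMod N) :
    cyclotomicCoset q N (s - r * j) = {s - r * j, s + r * j} := by
  ext x
  constructor
  · rintro ⟨e, rfl⟩
    exact mul_pow_two_mul_eq_or hs hr j e
  · rintro (rfl | rfl)
    · exact ⟨0, by simp⟩
    · exact ⟨1, by linear_combination j * hr - hs⟩

theorem iUnion_cyclotomicCoset_sub_mul {q N : ℕ} {s r : ZMod N} (hs : s * q ^ 2 = s)
    (hr : r * q ^ 2 = -r) (m : ℕ) :
    ⋃ j ∈ Finset.range (m + 1), cyclotomicCoset q N (s - r * j) =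
      (fun j : ℤ => s + r * j) '' Set.Icc (-m) m := by
  ext x
  simp only [cyclotomicCoset_sub_mul hs hr, Set.mem_iUnion, Finset.mem_range, exists_prop]
  constructor
  · rintro ⟨j, hj, rfl | rfl⟩
    · exact ⟨-j, ⟨by omega, by omega⟩, by push_cast; ring⟩
    · exact ⟨j, ⟨by omega, by omega⟩, by push_cast; ring⟩
  · rintro ⟨j, ⟨hj, hj'⟩, rfl⟩
    refine ⟨j.natAbs, by omega, ?_⟩
    obtain ⟨i, rfl | rfl⟩ := j.eq_nat_or_neg
    · right; simp
    · left; simp [sub_eq_add_neg]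

variable {F K : Type*} [Field F] [Field K] [Algebra F K] {n r : ℕ} {α : F} {δ : K} {g : F[X]}
  {C : Submodule F (Fin n → F)}

namespace IsGeneratorPoly

theorem rootSet_eq_image_definingSet (hg : IsGeneratorPoly α C g) [NeZero (r * n)]
    (hδ : IsPrimitiveRoot δ (r * n)) (hδα : δ ^ n = algebraMap F K α) :
    g.rootSet K = (fun i : ZMod (r * n) => δ ^ i.val) '' definingSet r n δ g := by
  have hrn : r * n ≠ 0 := NeZero.ne _
  have hδ0 := hδ.ne_zero hrn
  have : NeZero n := ⟨right_ne_zero_of_mul hrn⟩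
  ext x
  constructor
  · intro hx
    have hxδ : (x / δ) ^ n = 1 := by
      rw [div_pow, hg.pow_eq_of_mem_rootSet hx, ← hδα, div_self (pow_ne_zero n hδ0)]
    obtain ⟨j, hj, hjx⟩ := (hδ.pow (Nat.pos_of_ne_zero hrn) rfl).eq_pow_of_pow_eq_one hxδ
    have hδx : δ ^ (1 + (r : ZMod (r * n)) * (j : ZMod (r * n))).val = x := by
      have hval := pow_val_intCast_of_isPrimitiveRoot hδ (1 + r * j : ℕ)
      rw [zpow_natCast, pow_add, pow_one, pow_mul, hjx, mul_div_cancel₀ x hδ0] at hval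
      simpa using hval
    refine ⟨_, ⟨⟨j, hj, rfl⟩, ?_⟩, hδx⟩
    rw [hδx, aeval_eq_zero_of_mem_rootSet hx]
  · rintro ⟨i, ⟨-, hi⟩, rfl⟩
    exact mem_rootSet.2 ⟨hg.monic.ne_zero, hi⟩

theorem rootSet_eq_image_of_definingSet_eq (hg : IsGeneratorPoly α C g) {q s m : ℕ}
    (hrn : r * n ≠ 0) (hδ : IsPrimitiveRoot δ (r * n)) (hδα : δ ^ n = algebraMap F K α)
    (hs : (s : ZMod (r * n)) * q ^ 2 = s) (hr : (r : ZMod (r * n)) * q ^ 2 = -r)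
    (hT : definingSet r n δ g = ⋃ j ∈ Finset.range (m + 1),
      cyclotomicCoset q (r * n) ((s : ZMod (r * n)) - (r : ZMod (r * n)) * (j : ZMod (r * n)))) :
    g.rootSet K = (fun j : ℤ => δ ^ s * (δ ^ r) ^ j) '' Set.Icc (-m) m := by
  have : NeZero (r * n) := ⟨hrn⟩
  rw [hg.rootSet_eq_image_definingSet hδ hδα, hT, iUnion_cyclotomicCoset_sub_mul hs hr,
    Set.image_image]
  refine Set.image_congr fun j _ => ?_
  have hval := pow_val_intCast_of_isPrimitiveRoot hδ (s + r * j)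
  push_cast at hval
  rw [hval, zpow_add₀ (hδ.ne_zero hrn), zpow_mul, zpow_natCast, zpow_natCast]

end IsGeneratorPoly

end DefiningSet

section Parameters

theorem natCast_ne_zero_of_dvd_card_add_one {F : Type*} [Field F] [Fintype F] {n : ℕ}
    (hn : n ∣ Fintype.card F + 1) : (n : F) ≠ 0 := by
  obtain ⟨b, hb⟩ := hn
  have hcast := congrArg (Nat.cast (R := F)) hb
  push_cast at hcast
  rw [FiniteField.cast_card_eq_zero, zero_add] at hcast
  exact left_ne_zero_of_mul (hcast ▸ one_ne_zero)

theorem exists_eq_ten_mul_add_seven {q n s l : ℕ} (hq : q % 10 = 7) (hn : n = (q ^ 2 + 1) / 10)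
    (hs : s = (q ^ 2 + 1) / 2) (hl : (l : ℚ) ≤ ((q : ℚ) - 7) / 10) :
    ∃ t, l ≤ t ∧ q = 10 * t + 7 ∧ n = 10 * t ^ 2 + 14 * t + 5 ∧ s = 5 * n ∧
      q ^ 2 + 1 = 10 * n := by
  obtain ⟨t, rfl⟩ : ∃ t, q = 10 * t + 7 := ⟨q / 10, by omega⟩
  have hsq : (10 * t + 7) ^ 2 + 1 = 10 * (10 * t ^ 2 + 14 * t + 5) := by ring
  have hlt : (l : ℚ) ≤ t := by
    push_cast at hl
    linarith
  exact ⟨t, mod_cast hlt, rfl, by omega, by omega, by omega⟩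

theorem cast_eq_of_add_nine_eq {q n t l k : ℕ} (hq : q = 10 * t + 7)
    (hk : n + 9 = 2 * (2 * (4 * t + 3 + l) + 1) + k) :
    (k : ℚ) = n - 4 / 5 * (2 * q + 1) - 4 * l + 7 := by
  have hkQ : (n : ℚ) + 9 = 2 * (2 * (4 * t + 3 + l) + 1) + k := mod_cast hk
  push_cast [hq]
  linarith

theorem cast_le_half_of_two_le {n t m : ℕ} (hn : n = 10 * t ^ 2 + 14 * t + 5) (ht : 2 ≤ t)
    (hm : m ≤ 5 * t + 3) : ((2 * m + 2 : ℕ) : ℚ) ≤ ((n : ℚ) + 2) / 2 := by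
  have h2t : 2 * t ≤ t ^ 2 := sq t ▸ Nat.mul_le_mul_right t ht
  rw [le_div_iff₀ two_pos]
  exact_mod_cast (by omega : (2 * m + 2) * 2 ≤ n + 2)

open Polynomial in
theorem IsGeneratorPoly.hasRootInterval_of_definingSet_eq {F K : Type*} [Field F] [Field K]
    [Algebra F K] {q n b s m : ℕ} {α : F} {δ : K} {g : F[X]} {C : Submodule F (Fin n → F)}
    (hg : IsGeneratorPoly α C g) (hδ : IsPrimitiveRoot δ ((q + 1) * n))
    (hδα : δ ^ n = algebraMap F K α) (hn : n ≠ 0) (hq : q ^ 2 + 1 = b * n) (hs : n ∣ s)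
    (hT : definingSet (q + 1) n δ g = ⋃ j ∈ Finset.range (m + 1),
      cyclotomicCoset q ((q + 1) * n) ((s : ZMod ((q + 1) * n)) -
        ((q + 1 : ℕ) : ZMod ((q + 1) * n)) * (j : ZMod ((q + 1) * n)))) :
    HasRootInterval n m g (δ ^ s) (δ ^ (q + 1)) := by
  obtain ⟨a, rfl⟩ := hs
  have hmod : ((q + 1) * n : ZMod ((q + 1) * n)) = 0 := mod_cast ZMod.natCast_self ((q + 1) * n)
  have hqmod : (q ^ 2 + 1 : ZMod ((q + 1) * n)) = b * n := mod_cast congrArg Nat.cast hq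
  have hrn : (q + 1) * n ≠ 0 := mul_ne_zero q.succ_ne_zero hn
  have hζ : IsPrimitiveRoot (δ ^ (q + 1)) n := hδ.pow (Nat.pos_of_ne_zero hrn) rfl
  refine ⟨hζ, pow_ne_zero _ (hδ.ne_zero hrn), hg.splits_map hn hζ hδα,
    hg.rootSet_eq_image_of_definingSet_eq hrn hδ hδα ?_ ?_ hT⟩
  · push_cast
    linear_combination (a * (q - 1) : ZMod ((q + 1) * n)) * hmod
  · push_cast
    linear_combination (q + 1 : ZMod ((q + 1) * n)) * hqmod + (b : ZMod ((q + 1) * n)) * hmod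

end Parameters

theorem mainTheorem2 (q n r s l : ℕ) (hq : IsPrimePow q) (hq7 : q % 10 = 7)
    (hn : n = (q ^ 2 + 1) / 10) (hr : r = q + 1) (hs : s = (q ^ 2 + 1) / 2)
    (hl1 : 1 ≤ l) (hl2 : (l : ℚ) ≤ ((q : ℚ) - 7) / 10)
    {F : Type*} [Field F] [Fintype F] [DecidableEq F] (hF : Fintype.card F = q ^ 2)
    {K : Type*} [Field K] [Algebra F K]
    (α : F) (hα : IsPrimitiveRoot α r)
    (δ : K) (hδ : IsPrimitiveRoot δ (r * n)) (hδα : δ ^ n = algebraMap F K α)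
    (C : Submodule F (Fin n → F)) (hC : IsConstacyclic α C)
    (g : Polynomial F) (hg : IsGeneratorPoly α C g)
    (hT : definingSet r n δ g =
      ⋃ j ∈ Finset.range ((2 * q + 1) / 5 + l + 1),
        cyclotomicCoset q (r * n) ((s : ZMod (r * n)) - (r : ZMod (r * n)) * (j : ZMod (r * n)))) :
    ∃ k d : ℕ,
      (k : ℚ) = n - 4 / 5 * (2 * q + 1) - 4 * l + 7 ∧
      (d : ℚ) = 2 / 5 * (2 * q + 1) + 2 * l + 2 ∧
      HasMinWeight C d ∧
      (k : ℤ) = 2 * Module.finrank F C - n + 9 ∧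
      (∀ (m : ℕ) (H : Matrix (Fin m) (Fin n) F), IsParityCheck C H →
        (H * hermTranspose q H).rank = 9) ∧
      ∃ Q : EACode q n k 9, Q.HasMinDist d ∧ MeetsEASingleton n k d 9 ∧
        (q ≠ 17 → Q.IsEAQMDS d) := by
  obtain ⟨t, hlt, hqt, hnt, rfl, hqn⟩ := exists_eq_ten_mul_add_seven hq7 hn hs hl2
  obtain ⟨m, hm⟩ : ∃ m, m = 4 * t + 3 + l := ⟨_, rfl⟩
  have ht : t ≤ t ^ 2 := Nat.le_self_pow two_ne_zero t
  have hn0 : n ≠ 0 := by omega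
  rw [show (2 * q + 1) / 5 + l = m by omega] at hT
  subst hr
  have hnF : (n : F) ≠ 0 := natCast_ne_zero_of_dvd_card_add_one (hF ▸ hqn ▸ dvd_mul_left n 10)
  have hsep := hg.separable hnF (hα.ne_zero q.succ_ne_zero)
  have hroots := hg.hasRootInterval_of_definingSet_eq hδ hδα hn0 hqn (dvd_mul_left n 5) hT
  have hβ : (δ ^ (5 * n)) ^ (q + 1) = 1 := by
    rw [← pow_mul, hδ.pow_eq_one_iff_dvd]
    exact ⟨5, by ring⟩
  have hrank (b : ℕ) (H : Matrix (Fin b) (Fin n) F) (hH : IsParityCheck C H) :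
      (H * hermTranspose q H).rank = 9 := hroots.rank_mul_hermTranspose_eq_nine hg hF hH hnF
    hα.pow_eq_one hβ hqt hnt (hl1.trans hlt) (by omega) (by omega)
  obtain ⟨b, H, hH⟩ := exists_isParityCheck C
  obtain ⟨k, hk⟩ : ∃ k, n + 9 = 2 * (2 * m + 1) + k := Nat.exists_eq_add_of_le (by omega)
  obtain ⟨Q, hQ⟩ := hroots.exists_eaCode hg hsep hF (Nat.odd_iff.2 (by omega)) hH
    (hrank b H hH) (by omega) hk (by omega)
  have hsing : MeetsEASingleton n k (2 * m + 2) 9 := by unfold MeetsEASingleton; omega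
  refine ⟨k, 2 * m + 2, ?_, ?_, hroots.hasMinWeight hg hsep (by omega), ?_, hrank, Q, hQ, hsing,
    fun hq17 => ⟨hQ, hsing, ?_⟩⟩
  · exact cast_eq_of_add_nine_eq hqt (hm ▸ hk)
  · push_cast [hm, hqt]
    ring
  · rw [hg.finrank_eq, hroots.natDegree_eq hsep (by omega)]
    omega
  · exact cast_le_half_of_two_le hnt (by omega) (by omega)
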